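/- Let $G$ be a connected undirected graph with finite non-empty vertex set $V$ and finitely many edges; multiple edges are allowed and loops are disregarded. Let $L$ be its Laplacian matrix ($L_{vv}$ is the degree of $v$, and for $u\ne v$, $-L_{uv}$ is the number of edges joining $u$ and $v$), and let $\operatorname{Cl}(G)=\mathbb{Z}^V/L\,\mathbb{Z}^V$. For $D\in\mathbb{Z}^V$ write $|D|$ for the set of vectors $D_0\in\mathbb{Z}^V$ with $D_0\ge 0$ and the same class as $D$ in $\operatorname{Cl}(G)$, and let $\Delta_D$ be the simplicial complex of all $W\subseteq V$ contained in the support of some $D_0\in|D|$. Grade $S=\mathbb{C}[x_v: v\in V]$ by $\operatorname{Cl}(G)$, where $x_v$ has the class of the unit vector $1_v$ as its degree, and let $$I=\big\langle x^a-x^b : a,b\in\mathbb{N}^V,\ a-b\in L\,\mathbb{Z}^V\big\rangle\subseteq S$$ be the homogeneous toppling ideal of $G$. Then $S/I$ has a minimal $\operatorname{Cl}(G)$-graded free resolution $\cdots\to F_2\to F_1\to F_0\to S/I\to 0$ with all $F_k$ of finite rank. For any such resolution let $\beta_{k,D}$ be the number of basis elements of $F_k$ of degree $D\in\operatorname{Cl}(G)$,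 and let $\beta_k=\sum_{D\in\operatorname{Cl}(G)}\beta_{k,D}$. Then: 1. $\beta_1$ is equal to the number of cuts of $G$, that is, to the number of (unordered) partitions of $V$ into two non-empty parts, each of which induces a connected subgraph of $G$. 2. For every $D\in\operatorname{Cl}(G)$, $\beta_{1,D}=\dim_{\mathbb{C}}\widetilde H_0(\Delta_D;\mathbb{C})$. 3. Wilmes' conjecture holds for $k=1$: $$\beta_1=\sum_{\Pi}\#\{\text{maximal } G_\Pi\text{-parking functions}\},$$ where the sum runs over the cuts $\Pi$ of $G$, and $G_\Pi$ is the two-vertex multigraph obtained by contracting each part of $\Pi$ to a vertex, with an arbitrarily chosen sink. Here, for a graph $H$ with sink $s$ and Laplacian $L_H$, an $H$-parking function is a vector $c$ of non-negative integers indexed by the vertices $v\neq s$ such that there is no non-zero integer vector $\sigma\ge 0$ on the vertices of $H$ with $\sigma_s=0$ and $c_v-(L_H\sigma)_v\ge 0$ for all $v\ne s$; it is maximal if $c+1_v$ is not an $H$-parking function for any $v\neq s$. -/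

import Mathlib

noncomputable section

/-! ### Multigraded minimal free resolutions over `ℂ[x_v : v ∈ σ]` -/

/-- Let `S = ℂ[x_v : v ∈ σ]` be graded by an abelian group `A`, with `deg x_v = w v`. A minimal
`A`-graded free resolution
`⋯ → F₂ → F₁ → F₀ → S ⧸ I → 0`
of `S ⧸ I` by free modules `F_i = S ^ (rank i)` of finite rank, whose standard basis vectors `e_j`
are homogeneous of degree `deg i j`. All maps are homogeneous of degree `0`, the complex is exact,
and the entries of the matrices of `F_{i+1} → F_i` lie in the ideal generated by the variables. -/
structure MinimalFreeResolution {σ A : Type*} [AddCommGroup A] (w : σ → A)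
    (I : Ideal (MvPolynomial σ ℂ)) where
  rank : ℕ → ℕ
  deg : ∀ i, Fin (rank i) → A
  d : ∀ i, (Fin (rank (i + 1)) → MvPolynomial σ ℂ) →ₗ[MvPolynomial σ ℂ]
    (Fin (rank i) → MvPolynomial σ ℂ)
  aug : (Fin (rank 0) → MvPolynomial σ ℂ) →ₗ[MvPolynomial σ ℂ] (MvPolynomial σ ℂ ⧸ I)
  aug_surjective : Function.Surjective aug
  exact_aug : Function.Exact (d 0) aug
  exact_d : ∀ i, Function.Exact (d (i + 1)) (d i)
  homogeneous_d : ∀ i (j : Fin (rank (i + 1))) (j' : Fin (rank i)),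
    MvPolynomial.IsWeightedHomogeneous w (d i (Pi.single j 1) j') (deg (i + 1) j - deg i j')
  homogeneous_aug : ∀ j : Fin (rank 0), ∃ p : MvPolynomial σ ℂ,
    MvPolynomial.IsWeightedHomogeneous w p (deg 0 j) ∧
      aug (Pi.single j 1) = Ideal.Quotient.mk I p
  minimal : ∀ i (j : Fin (rank (i + 1))) (j' : Fin (rank i)),
    d i (Pi.single j 1) j' ∈ Ideal.span (Set.range (MvPolynomial.X : σ → MvPolynomial σ ℂ))

namespace MinimalFreeResolution

variable {σ A : Type*} [AddCommGroup A] {w : σ → A} {I : Ideal (MvPolynomial σ ℂ)}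

/-- The fine Betti number `β_{k,D}`: the number of basis elements of degree `D` in `F_k`. -/
def betti (F : MinimalFreeResolution w I) (k : ℕ) (D : A) : ℕ :=
  {j : Fin (F.rank k) | F.deg k j = D}.ncard

/-- The coarse Betti number `β_k = ∑_D β_{k,D}` (only finitely many terms are nonzero). -/
def coarseBetti (F : MinimalFreeResolution w I) (k : ℕ) : ℕ :=
  ∑ᶠ D : A, F.betti k D

end MinimalFreeResolution

/-! ### Reduced homology in degree zero -/

section ReducedHomology

variable {ι : Type*} [Fintype ι]

open Classical in
/-- The augmentation `C₀(Δ, ℂ) → ℂ`, where `C₀(Δ, ℂ)` is the space with the vertices of `Δ` as a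
basis, realized as the functions on the finite set of vertices. -/
def simplicialAugmentation (Δ : Set (Finset ι)) : ({v : ι // {v} ∈ Δ} → ℂ) →ₗ[ℂ] ℂ :=
  ∑ v, LinearMap.proj v

open Classical in
/-- The image of `∂₁ : C₁(Δ, ℂ) → C₀(Δ, ℂ)`, spanned by the boundaries of the edges of `Δ`. -/
def simplicialBoundaries (Δ : Set (Finset ι)) : Submodule ℂ ({v : ι // {v} ∈ Δ} → ℂ) :=
  Submodule.span ℂ {x | ∃ u v : {v : ι // {v} ∈ Δ}, ({u.1, v.1} : Finset ι) ∈ Δ ∧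
    x = Pi.single v 1 - Pi.single u 1}

/-- The reduced homology `H̃₀(Δ, ℂ)` of a simplicial complex given by its set of faces: the kernel
of the augmentation modulo the image of `∂₁`. -/
abbrev ReducedHomologyZero (Δ : Set (Finset ι)) : Type _ :=
  LinearMap.ker (simplicialAugmentation Δ) ⧸
    (simplicialBoundaries Δ).submoduleOf (LinearMap.ker (simplicialAugmentation Δ))

end ReducedHomology

namespace Graph

variable {α β : Type*} (G : Graph α β)

/-! ### Cuts of a multigraph -/

/-- The underlying simple graph. -/
def underlying : SimpleGraph G.vertexSet where
  Adj u v := u ≠ v ∧ ∃ e, G.IsLink e u v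
  symm := ⟨fun _ _ h => ⟨h.1.symm, h.2.imp fun _ he => he.symm⟩⟩
  loopless := ⟨fun _ h => h.1 rfl⟩

/-- The partitions of the vertex set into `k` (nonempty) connected parts. For `k = 2` these are
the cuts of `G`. -/
def connectedPartitions (k : ℕ) : Set (Set (Set G.vertexSet)) :=
  {P | Setoid.IsPartition P ∧ P.ncard = k ∧ ∀ A ∈ P, (G.underlying.induce A).Connected}

/-- The multigraph `G_Π` obtained by contracting each part of a partition to a vertex. An edge of
`G` inside a part becomes a loop. -/
def contract (P : Set (Set G.vertexSet)) (hP : Setoid.IsPartition P) :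
    Graph (Set G.vertexSet) β where
  vertexSet := P
  IsLink e A B := A ∈ P ∧ B ∈ P ∧ ∃ u ∈ A, ∃ v ∈ B, G.IsLink e u v
  isLink_symm _ _ := ⟨fun _ _ ⟨hA, hB, u, hu, v, hv, h⟩ => ⟨hB, hA, v, hv, u, hu, h.symm⟩⟩
  eq_or_eq_of_isLink_of_isLink := by
    rintro e A B C D ⟨hA, -, u, hu, v, -, h⟩ ⟨hC, hD, u', hu', v', hv', h'⟩
    rcases G.eq_or_eq_of_isLink_of_isLink h h' with huu | huv
    · left
      have : u = u' := Subtype.ext huu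
      subst this
      exact (hP.2 u).unique ⟨hA, hu⟩ ⟨hC, hu'⟩
    · right
      have : u = v' := Subtype.ext huv
      subst this
      exact (hP.2 u).unique ⟨hA, hu⟩ ⟨hD, hv'⟩
  left_mem_of_isLink _ _ _ h := h.1

instance contractFintype [Finite G.vertexSet] (P : Set (Set G.vertexSet))
    (hP : Setoid.IsPartition P) : Fintype (G.contract P hP).vertexSet :=
  Fintype.ofFinite _

/-! ### The Laplacian, divisors and the toppling ideal -/

/-- The number of edges joining `u` and `v`. -/
def multiplicity (u v : G.vertexSet) : ℕ := {e | G.IsLink e u v}.ncard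

variable [Fintype G.vertexSet]

open Classical in
/-- The Laplacian matrix. Loops are disregarded. -/
def laplacian : Matrix G.vertexSet G.vertexSet ℤ :=
  Matrix.of fun u v =>
    if u = v then ∑ x ∈ Finset.univ.filter (fun x => x ≠ u), (G.multiplicity u x : ℤ)
    else -(G.multiplicity u v : ℤ)

/-- The class group `Cl(G) = ℤV / im L`. -/
abbrev ClGroup : Type _ :=
  (G.vertexSet → ℤ) ⧸ LinearMap.range G.laplacian.mulVecLin

/-- The class of a divisor. -/
def divClass (D : G.vertexSet → ℤ) : G.ClGroup := Submodule.Quotient.mk D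

open Classical in
/-- The `Cl(G)`-grading of `ℂ[x_v : v ∈ V]`: the degree of `x_v` is the class of the divisor `1_v`.
-/
def varDegree (v : G.vertexSet) : G.ClGroup := G.divClass (Pi.single v 1)

/-- The homogeneous toppling ideal, generated by the binomials `x^a - x^b` with `a ∼ b`. -/
def topplingIdeal : Ideal (MvPolynomial G.vertexSet ℂ) :=
  Ideal.span {p | ∃ a b : G.vertexSet →₀ ℕ,
    G.divClass (fun v => (a v : ℤ)) = G.divClass (fun v => (b v : ℤ)) ∧
      p = MvPolynomial.monomial a 1 - MvPolynomial.monomial b 1}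

/-- The linear system `|D|`, the set of effective divisors in a given class. -/
def linearSystem (D : G.ClGroup) : Set (G.vertexSet → ℤ) :=
  {D₀ | 0 ≤ D₀ ∧ G.divClass D₀ = D}

/-- The simplicial complex `Δ_D`: the sets contained in the support of some member of `|D|`. -/
def supportComplex (D : G.ClGroup) : Set (Finset G.vertexSet) :=
  {W | ∃ D₀ ∈ G.linearSystem D, (W : Set G.vertexSet) ⊆ Function.support D₀}

/-! ### Parking functions -/

/-- `c`, a configuration of chips on the vertices other than the sink `s`, is a `G`-parking function
if no nonzero script that does not fire the sink leaves all these vertices nonnegative. -/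
def IsParking (s : G.vertexSet) (c : {v : G.vertexSet // v ≠ s} → ℕ) : Prop :=
  ¬ ∃ τ : G.vertexSet → ℤ, 0 ≤ τ ∧ τ ≠ 0 ∧ τ s = 0 ∧
    ∀ v : {v : G.vertexSet // v ≠ s}, 0 ≤ (c v : ℤ) - G.laplacian.mulVec τ v

open Classical in
/-- The maximal `G`-parking functions with respect to the sink `s`. -/
def maximalParking (s : G.vertexSet) : Set ({v : G.vertexSet // v ≠ s} → ℕ) :=
  {c | G.IsParking s c ∧ ∀ v, ¬ G.IsParking s (c + Pi.single v 1)}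

end Graph

end

/-! Write 𝔪 for the ideal of the variables. In a minimal resolution `F₀` has rank one and the images
of the basis of `F₁` are minimal homogeneous generators of `I`, so `β_{1,D}` is the dimension of the
degree `D` part of `I / 𝔪I` (`betti_one_eq_finrank`). For the toppling ideal both parts are spanned
by binomials: `I` by all `x^a - x^b` with `a ∼ b`, and `𝔪I` by those whose exponents share a vertex
of their supports (`restrictScalars_maximal_mul_binomialIdeal`). Hence `(I / 𝔪I)_D` is the space of
zero-sum combinations of effective divisors in `D`, with two divisors identified when their supports
meet. Exchanging divisors for vertices of their supports turns this into `H̃₀(Δ_D)`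
(`finrank_reducedHomologyZero_eq`).

To count generators, any two equivalent effective divisors are joined by legal firings of sets
(`chain_induction`). A firing whose two ends have disjoint supports goes from `bd U` to `bd Uᶜ`
(`eq_bd_of_disjoint`), and its binomial lies in `𝔪I` if `U` or `Uᶜ` is nonempty and disconnected
(`exists_meeting_of_not_conn`). So the binomials of cuts span. For independence, each cut `U` with
`q ∉ U` splits the effective divisors of its class into two sides. The only legal firing that leaves
the far side is the cut itself (`eq_of_leave_farSide`), so divisors with meeting supports lie on the
same side (`farSide_of_common_support`). The indicator functionals of the far sides are therefore
dual to the cut binomials.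

The parking function formula follows because a two-vertex multigraph whose vertices are joined by an
edge has exactly one maximal parking function. -/

noncomputable section

/-! ### Chip firing on a finite set with edge multiplicities -/

namespace ChipFiring

/-- The Laplacian of a multigraph with edge multiplicities `m`, as a linear map on scripts. -/
def lap {V : Type*} [Fintype V] (m : V → V → ℕ) : (V → ℤ) →ₗ[ℤ] (V → ℤ) where
  toFun σ v := ∑ w, (m v w : ℤ) * (σ v - σ w)
  map_add' σ τ := by
    ext v
    simp only [Pi.add_apply, ← Finset.sum_add_distrib]
    exact Finset.sum_congr rfl fun w _ => by ring
  map_smul' c σ := by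
    ext v
    simp only [Pi.smul_apply, smul_eq_mul, RingHom.id_apply, Finset.mul_sum]
    exact Finset.sum_congr rfl fun w _ => by ring

/-- A nonempty set of vertices that is connected: it has no proper nonempty subset that is closed
under passing to neighbours. -/
def Conn {V : Type*} (m : V → V → ℕ) (A : Set V) : Prop :=
  A.Nonempty ∧ ∀ X ⊆ A, X.Nonempty → (∀ x ∈ X, ∀ y ∈ A, 0 < m x y → y ∈ X) → A ⊆ X

open Classical in
/-- The script firing every vertex of `U` once. -/
def ind {V : Type*} (U : Set V) : V → ℤ := fun v => if v ∈ U then 1 else 0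

open Classical in
/-- The divisor having, at each vertex of `U`, as many chips as there are edges leaving `U`. -/
def bd {V : Type*} [Fintype V] (m : V → V → ℕ) (U : Set V) : V → ℤ :=
  fun v => ∑ w, if v ∈ U ∧ w ∉ U then (m v w : ℤ) else 0

variable {V : Type*} {m : V → V → ℕ}

lemma ind_of_mem {U : Set V} {v : V} (h : v ∈ U) : ind U v = 1 := by simp [ind, h]

lemma ind_of_notMem {U : Set V} {v : V} (h : v ∉ U) : ind U v = 0 := by simp [ind, h]

lemma ind_nonneg (U : Set V) (v : V) : 0 ≤ ind U v := by unfold ind; split_ifs <;> simp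

lemma ind_le_one (U : Set V) (v : V) : ind U v ≤ 1 := by unfold ind; split_ifs <;> simp

lemma Conn.exists_edge (hm : Conn m Set.univ) {X : Set V} (hX : X.Nonempty) (hX' : X ≠ Set.univ) :
    ∃ x ∈ X, ∃ y ∉ X, 0 < m x y := by
  by_contra hc
  push Not at hc
  refine hX' (Set.univ_subset_iff.1 (hm.2 X (Set.subset_univ _) hX fun x hx y _ h => ?_))
  by_contra hy
  exact h.ne' (by simpa using hc x hx y hy)

variable [Fintype V]

lemma lap_apply (σ : V → ℤ) (v : V) : lap m σ v = ∑ w, (m v w : ℤ) * (σ v - σ w) := rfl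

lemma bd_nonneg (U : Set V) : 0 ≤ bd m U := fun v => by
  refine Finset.sum_nonneg fun w _ => ?_
  split_ifs <;> simp

lemma bd_of_notMem {U : Set V} {v : V} (h : v ∉ U) : bd m U v = 0 := by simp [bd, h]

lemma bd_pos {U : Set V} {v w : V} (hv : v ∈ U) (hw : w ∉ U) (h : 0 < m v w) : 0 < bd m U v := by
  refine Finset.sum_pos' (fun w _ => by split_ifs <;> simp) ⟨w, Finset.mem_univ _, ?_⟩
  simp [hv, hw, h]

lemma exists_of_bd_pos {U : Set V} {v : V} (h : 0 < bd m U v) :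
    v ∈ U ∧ ∃ w, w ∉ U ∧ 0 < m v w := by
  by_contra hc
  push Not at hc
  refine h.ne' (Finset.sum_eq_zero fun w _ => ?_)
  split_ifs with hh
  · simpa using hc hh.1 w hh.2
  · rfl

lemma lap_ind (U : Set V) : lap m (ind U) = bd m U - bd m Uᶜ := by
  ext v
  simp only [lap_apply, bd, Pi.sub_apply, ← Finset.sum_sub_distrib, ind, Set.mem_compl_iff]
  refine Finset.sum_congr rfl fun w _ => ?_
  by_cases hv : v ∈ U <;> by_cases hw : w ∈ U <;> simp [hv, hw]

lemma lap_const (c : ℤ) : lap m (fun _ => c) = 0 := by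
  ext v
  simp [lap_apply]

/-- Maximum principle: at a maximum every term `m v w * (σ v - σ w)` is nonnegative, so a
nonpositive sum makes them all vanish. -/
lemma eq_of_lap_nonpos_of_isMax {σ : V → ℤ} {v : V} (hmax : ∀ w, σ w ≤ σ v) (h : lap m σ v ≤ 0) {w : V}
    (hw : 0 < m v w) : σ w = σ v := by
  have hnn : ∀ u ∈ Finset.univ, 0 ≤ (m v u : ℤ) * (σ v - σ u) := fun u _ =>
    mul_nonneg (by positivity) (sub_nonneg.2 (hmax u))
  have h0 := (Finset.sum_eq_zero_iff_of_nonneg hnn).1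
    (le_antisymm h (Finset.sum_nonneg hnn)) w (Finset.mem_univ _)
  rcases mul_eq_zero.1 h0 with h1 | h1
  · exact absurd h1 (by positivity)
  · linarith

/-- On a connected graph the scripts with trivial effect are constant. -/
lemma Conn.eq_of_lap_eq_zero (hm : Conn m Set.univ) {σ : V → ℤ} (h : lap m σ = 0) (u v : V) :
    σ u = σ v := by
  obtain ⟨x, -, hx⟩ := Finset.exists_max_image Finset.univ σ ⟨u, Finset.mem_univ _⟩
  have key := hm.2 {y | σ y = σ x} (Set.subset_univ _) ⟨x, rfl⟩ fun y hy z _ hyz => by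
    have hy' : σ y = σ x := hy
    exact (eq_of_lap_nonpos_of_isMax (fun w => by rw [hy']; exact hx w (Finset.mem_univ _))
      (by simp [h]) hyz).trans hy'
  exact (key (Set.mem_univ u) : σ u = σ x).trans (key (Set.mem_univ v) : σ v = σ x).symm

/-! ### Decomposing an equivalence into legal set firings -/

/-- Firing the set where a script is maximal is legal if firing the whole script is. -/
lemma nonneg_sub_lap_argmax {a σ : V → ℤ} (ha : 0 ≤ a) (hb : 0 ≤ a - lap m σ) {x : V}
    (hx : ∀ w, σ w ≤ σ x) : 0 ≤ a - lap m (ind {v | σ v = σ x}) := by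
  intro v
  have hav := ha v
  have hbv := hb v
  simp only [Pi.zero_apply, Pi.sub_apply] at *
  by_cases hv : σ v = σ x
  -- By integrality `σ` drops by at least 1 from the maximal set to any vertex outside it, so firing
  -- the set costs its vertices no more than firing `σ`. Vertices outside the set only gain chips.
  · refine hbv.trans (sub_le_sub_left (Finset.sum_le_sum fun w _ => ?_) _)
    refine mul_le_mul_of_nonneg_left ?_ (by positivity)
    have := hx w
    simp only [ind, Set.mem_ofPred_eq, hv, if_true]
    split_ifs <;> omega
  · have : lap m (ind {v | σ v = σ x}) v ≤ 0 := by
      refine Finset.sum_nonpos fun w _ => ?_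
      refine mul_nonpos_of_nonneg_of_nonpos (by positivity) ?_
      simp only [ind, Set.mem_ofPred_eq, hv, if_false]
      split_ifs <;> simp
    linarith

/-- Two equivalent effective divisors are joined by a chain of legal firings of sets. -/
lemma chain_induction {R : (V → ℤ) → (V → ℤ) → Prop} (hrefl : ∀ a, 0 ≤ a → R a a)
    (htrans : ∀ a b c, R a b → R b c → R a c)
    (hstep : ∀ a (U : Set V), 0 ≤ a → 0 ≤ a - lap m (ind U) → R a (a - lap m (ind U)))
    {a σ : V → ℤ} (ha : 0 ≤ a) (hb : 0 ≤ a - lap m σ) : R a (a - lap m σ) := by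
  -- Induction on the total number of firings: peel off the set where the script is maximal, which
  -- is legal to fire and leaves a smaller nonnegative script with the same endpoint.
  have main : ∀ n : ℕ, ∀ τ : V → ℤ, 0 ≤ τ → ∑ v, τ v = n → ∀ a, 0 ≤ a → 0 ≤ a - lap m τ →
      R a (a - lap m τ) := by
    intro n
    induction n using Nat.strong_induction_on with
    | _ n ih =>
      intro τ hτ hn a ha hb
      by_cases h0 : τ = 0
      · subst h0
        simpa using hrefl a ha
      obtain ⟨y, hy⟩ := Function.ne_iff.1 h0
      obtain ⟨x, -, hx⟩ := Finset.exists_max_image Finset.univ τ ⟨y, Finset.mem_univ _⟩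
      have hx' : ∀ w, τ w ≤ τ x := fun w => hx w (Finset.mem_univ _)
      have hpos : 1 ≤ τ x := by
        have h1 := hx' y
        have h2 : 0 ≤ τ y := hτ y
        have h3 : τ y ≠ 0 := hy
        omega
      set U : Set V := {v | τ v = τ x} with hU
      have hleg := nonneg_sub_lap_argmax ha hb hx'
      have hτ' : 0 ≤ τ - ind U := by
        intro v
        have h2 : 0 ≤ τ v := hτ v
        simp only [Pi.zero_apply, Pi.sub_apply]
        by_cases hv : v ∈ U
        · have hv' : τ v = τ x := hv
          rw [ind_of_mem hv]
          omega
        · rw [ind_of_notMem hv]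
          omega
      have hsum : ∑ v, (τ - ind U) v = (n : ℤ) - ∑ v, ind U v := by
        simp [← hn]
      have hge : 1 ≤ ∑ v, ind U v := by
        rw [← ind_of_mem (show x ∈ U from rfl)]
        exact Finset.single_le_sum (fun v _ => ind_nonneg U v) (Finset.mem_univ x)
      have hnn : 0 ≤ ∑ v, (τ - ind U) v := Finset.sum_nonneg fun v _ => hτ' v
      have heq : a - lap m (ind U) - lap m (τ - ind U) = a - lap m τ := by
        rw [map_sub]; abel
      obtain ⟨k, hk⟩ := Int.eq_ofNat_of_zero_le hnn
      have := ih k (by omega) (τ - ind U) hτ' hk _ hleg (by rwa [heq])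
      rw [heq] at this
      exact htrans _ _ _ (hstep a U ha hleg) this
  rcases isEmpty_or_nonempty V with hV | ⟨⟨y⟩⟩
  · have : a - lap m σ = a := Subsingleton.elim _ _
    rw [this]
    exact hrefl a ha
  -- Constant scripts have no effect, so subtracting the minimum makes the script nonnegative.
  obtain ⟨x, -, hx⟩ := Finset.exists_min_image Finset.univ σ ⟨y, Finset.mem_univ _⟩
  have heq : lap m (σ - fun _ => σ x) = lap m σ := by rw [map_sub, lap_const, sub_zero]
  have hnn : 0 ≤ σ - fun _ => σ x := fun v => sub_nonneg.2 (hx v (Finset.mem_univ _))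
  obtain ⟨k, hk⟩ := Int.eq_ofNat_of_zero_le (Finset.sum_nonneg fun v _ => hnn v)
  have := main k _ hnn hk a ha (by rwa [heq])
  rwa [heq] at this

/-- A legal set firing between divisors with disjoint supports is a cut firing. -/
lemma eq_bd_of_disjoint {a : V → ℤ} {U : Set V} (ha : 0 ≤ a) (hb : 0 ≤ a - lap m (ind U))
    (hd : ¬ ∃ v, 0 < a v ∧ 0 < (a - lap m (ind U)) v) :
    a = bd m U ∧ a - lap m (ind U) = bd m Uᶜ := by
  have key : a = bd m U := by
    ext v
    have hav := ha v
    have hbv := hb v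
    have hdv := not_exists.1 hd v
    have h1 : 0 ≤ bd m U v := bd_nonneg U v
    have h2 : 0 ≤ bd m Uᶜ v := bd_nonneg Uᶜ v
    simp only [lap_ind, Pi.sub_apply, Pi.zero_apply] at hav hbv hdv h1 h2
    -- On `U` either all chips are spent or there were none, and legality then gives `bd m U v = 0`.
    -- Off `U` no chips are lost, so any chip there would be common to both ends.
    by_cases hv : v ∈ U
    · rw [bd_of_notMem (show v ∉ Uᶜ from fun h => h hv)] at *
      omega
    · rw [bd_of_notMem hv] at *
      omega
  exact ⟨key, by rw [lap_ind, key]; abel⟩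

lemma bd_compl_eq (U : Set V) : bd m U - lap m (ind U) = bd m Uᶜ := by
  rw [lap_ind]; abel

lemma bd_disjoint (U : Set V) {v : V} (h : 0 < bd m U v) (h' : 0 < bd m Uᶜ v) : False :=
  (exists_of_bd_pos h').1 (exists_of_bd_pos h).1

/-- If `U` is disconnected, the two sides of the cut firing of `U` meet a common divisor. -/
lemma exists_meeting_of_not_conn (hsymm : ∀ u v, m u v = m v u) (hm : Conn m Set.univ)
    {U : Set V} (hU : U.Nonempty) (hUc : ¬ Conn m U) :
    ∃ σ : V → ℤ, 0 ≤ bd m U - lap m σ ∧ (∃ v, 0 < bd m U v ∧ 0 < (bd m U - lap m σ) v) ∧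
      ∃ v, 0 < bd m Uᶜ v ∧ 0 < (bd m U - lap m σ) v := by
  unfold Conn at hUc
  push Not at hUc
  obtain ⟨A, hAU, hA, hcl, hnot⟩ := hUc hU
  obtain ⟨b, hbU, hbA⟩ := Set.not_subset.1 hnot
  have hval : ∀ v, v ∉ A → lap m (ind A) v = -bd m Aᶜ v := fun v hv => by
    rw [lap_ind, Pi.sub_apply, bd_of_notMem hv, zero_sub]
  -- Fire only `A`, a proper union of components of `U`. Its outgoing edges all leave `U`, so each
  -- vertex of `A` spends exactly its chips. The chips on `U \ A` remain, and the neighbours of `A`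
  -- outside `U` receive some.
  refine ⟨ind A, fun v => ?_, ?_, ?_⟩
  · simp only [Pi.zero_apply, Pi.sub_apply]
    by_cases hv : v ∈ A
    · have : lap m (ind A) v = bd m U v := by
        rw [lap_ind, Pi.sub_apply, bd_of_notMem (show v ∉ Aᶜ from fun h => h hv), sub_zero]
        refine Finset.sum_congr rfl fun w _ => ?_
        by_cases hw : w ∈ U
        · by_cases hwA : w ∈ A
          · simp [hw, hwA]
          · have : m v w = 0 := by
              by_contra h
              exact hwA (hcl v hv w hw (Nat.pos_of_ne_zero h))
            simp [this]
        · have hwA : w ∉ A := fun h => hw (hAU h)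
          simp [hv, hAU hv, hw, hwA]
      rw [this, sub_self]
    · rw [hval v hv]
      have h1 : 0 ≤ bd m U v := bd_nonneg U v
      have h2 : 0 ≤ bd m Aᶜ v := bd_nonneg Aᶜ v
      omega
  · obtain ⟨x, ⟨hxU, hxA⟩, y, hy, hxy⟩ := hm.exists_edge (X := U \ A) ⟨b, hbU, hbA⟩
      (fun h => by
        obtain ⟨c, hc⟩ := hA
        exact (h ▸ Set.mem_univ c : c ∈ U \ A).2 hc)
    have hyU : y ∉ U := fun h => by
      have hyA : y ∈ A := by
        by_contra hyA
        exact hy ⟨h, hyA⟩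
      exact hxA (hcl y hyA x hxU (by rwa [hsymm]))
    have hpos : 0 < bd m U x := bd_pos hxU hyU hxy
    refine ⟨x, hpos, ?_⟩
    rw [Pi.sub_apply, hval x hxA]
    have h2 : 0 ≤ bd m Aᶜ x := bd_nonneg Aᶜ x
    omega
  · obtain ⟨x, hxA, y, hyA, hxy⟩ := hm.exists_edge hA (fun h => hbA (h ▸ Set.mem_univ b))
    have hyU : y ∉ U := fun h => hyA (hcl x hxA y h hxy)
    refine ⟨y, bd_pos hyU (not_not.2 (hAU hxA)) (by rwa [hsymm]), ?_⟩
    rw [Pi.sub_apply, hval y hyA, bd_of_notMem hyU]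
    have := bd_pos (m := m) (U := Aᶜ) hyA (not_not.2 hxA) (by rwa [hsymm])
    omega

/-- From the divisor of a cut not containing `q`, the only legal firing of a nonempty set not
containing `q` is the cut itself. -/
lemma eq_of_legal {q : V} {U Y : Set V} (hU : Conn m U) (hU' : Conn m Uᶜ)
    (hqU : q ∉ U) (hY : Y.Nonempty) (hqY : q ∉ Y) (hleg : 0 ≤ bd m U - lap m (ind Y)) :
    Y = U := by
  have hval : ∀ v ∈ Y, bd m Y v ≤ bd m U v := fun v hv => by
    have := hleg v
    rw [lap_ind, Pi.sub_apply, Pi.sub_apply,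
      bd_of_notMem (show v ∉ Yᶜ from fun h => h hv)] at this
    simp only [Pi.zero_apply] at this
    omega
  -- A vertex of `Y` outside `U` has no chips to spend, so it has no edge leaving `Y`. Then `Y ∩ Uᶜ`
  -- would be closed in the connected set `Uᶜ` and contain `q`.
  have hYU : Y ⊆ U := by
    by_contra hc
    obtain ⟨y, hy, hyU⟩ := Set.not_subset.1 hc
    refine hqY (hU'.2 (Y ∩ Uᶜ) Set.inter_subset_right ⟨y, hy, hyU⟩ ?_ hqU).1
    intro x hx z hz hxz
    refine ⟨?_, hz⟩
    by_contra hzY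
    have h1 := hval x hx.1
    rw [bd_of_notMem (show x ∉ U from hx.2)] at h1
    exact absurd (bd_pos hx.1 hzY hxz) (not_lt.2 h1)
  -- A vertex of `Y` with an edge into `U \ Y` pays for that edge as well as for all its edges
  -- leaving `U`, which exceeds its chips.
  refine hYU.antisymm (hU.2 Y hYU hY fun x hx y hy hxy => ?_)
  by_contra hyY
  have h1 := hval x hx
  have h2 : bd m U x < bd m Y x := by
    refine Finset.sum_lt_sum (fun w _ => ?_) ⟨y, Finset.mem_univ _, ?_⟩
    · by_cases hw : w ∈ U
      · simp only [hw, not_true, and_false, if_false]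
        split_ifs <;> simp
      · have hwY : w ∉ Y := fun h => hw (hYU h)
        simp [hx, hYU hx, hw, hwY]
    · simp [hx, hy, hyY, hxy]
  omega

/-! ### The two sides of a cut -/

/-- The divisors on the far side from `q` of the cut `U`: those from which `bd m U` is reached
without firing `q`. -/
def FarSide (m : V → V → ℕ) (q : V) (U : Set V) (b : V → ℤ) : Prop :=
  ∃ σ : V → ℤ, b = bd m U - lap m σ ∧ ∀ v, σ v ≤ σ q

lemma farSide_bd (q : V) (U : Set V) : FarSide m q U (bd m U) := ⟨0, by simp, fun _ => le_rfl⟩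

/-- On a connected graph the script between two divisors is unique up to constants. Here it is `ind
U` plus a constant, which is larger on `U` than at `q`. -/
lemma not_farSide_bd_compl (hm : Conn m Set.univ) {q : V} {U : Set V} (hqU : q ∉ U)
    (hU : U.Nonempty) : ¬ FarSide m q U (bd m Uᶜ) := by
  rintro ⟨σ, hσ, hmax⟩
  obtain ⟨u, hu⟩ := hU
  have h0 : lap m (σ - ind U) = 0 := by
    rw [← bd_compl_eq] at hσ
    rw [map_sub, sub_eq_zero]
    exact (sub_right_injective hσ).symm
  have h1 := hm.eq_of_lap_eq_zero h0 u q
  have h2 := hmax u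
  rw [Pi.sub_apply, Pi.sub_apply, ind_of_mem hu, ind_of_notMem hqU] at h1
  omega

/-- The only legal set firing leaving the far side of a cut is the cut itself. -/
lemma eq_of_leave_farSide {q : V} {U Y : Set V} (hU : Conn m U)
    (hU' : Conn m Uᶜ) (hqU : q ∉ U) {b : V → ℤ} (hb : 0 ≤ b) (hb' : 0 ≤ b - lap m (ind Y))
    (hP : FarSide m q U b) (hN : ¬ FarSide m q U (b - lap m (ind Y))) :
    b = bd m U ∧ Y = U := by
  obtain ⟨σ, rfl, hmax⟩ := hP
  have heq : bd m U - lap m σ - lap m (ind Y) = bd m U - lap m (σ + ind Y) := by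
    rw [map_add]; abel
  rw [heq] at hb' hN
  -- Leaving the far side means that some `y` overtakes `q`. As `ind Y` is 0 or 1, this forces `y ∈
  -- Y`, `q ∉ Y` and a previous tie `σ y = σ q`.
  have hN' : ∃ y, (σ + ind Y) q < (σ + ind Y) y := by
    by_contra hc
    push Not at hc
    exact hN ⟨_, rfl, hc⟩
  obtain ⟨y, hy⟩ := hN'
  have hyq := hmax y
  have hy1 := ind_le_one Y y
  have hq0 := ind_nonneg Y q
  simp only [Pi.add_apply] at hy
  have hyY : y ∈ Y := by
    by_contra h
    rw [ind_of_notMem h] at hy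
    omega
  have hqY : q ∉ Y := fun h => by
    rw [ind_of_mem h] at hy
    omega
  rw [ind_of_mem hyY, ind_of_notMem hqY] at hy
  have hσy : σ y = σ q := by omega
  have hmax' : ∀ w, (σ + ind Y) w ≤ (σ + ind Y) y := fun w => by
    have h1 := hmax w
    have h2 := ind_le_one Y w
    simp only [Pi.add_apply, ind_of_mem hyY]
    omega
  have hleg := nonneg_sub_lap_argmax (bd_nonneg U) hb' hmax'
  -- The maximal set of the new script is the part of `Y` tied with `q`. It avoids `q` and fires
  -- legally from `bd m U`, so `eq_of_legal` identifies it with `U`.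
  have hset : {v | (σ + ind Y) v = (σ + ind Y) y} = {v | v ∈ Y ∧ σ v = σ q} := by
    ext v
    simp only [Pi.add_apply, Set.mem_ofPred_eq, ind_of_mem hyY]
    have h1 := hmax v
    by_cases hv : v ∈ Y
    · rw [ind_of_mem hv]
      simp only [hv, true_and]
      omega
    · rw [ind_of_notMem hv]
      simp only [hv, false_and, iff_false]
      omega
  rw [hset] at hleg
  have hYU := eq_of_legal (Y := {v | v ∈ Y ∧ σ v = σ q}) hU hU' hqU ⟨y, hyY, hσy⟩
    (fun h => hqY h.1) hleg
  -- Off `U` the divisor `bd m U` has no chips, so effectiveness of `b` gives `lap m σ ≤ 0` there.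
  -- The maximum principle then carries the value `σ q` from `q` through the connected set `Uᶜ`, and
  -- `σ` is constant.
  have hout : Uᶜ ⊆ {v | v ∈ Uᶜ ∧ σ v = σ q} := by
    refine hU'.2 _ (fun v hv => hv.1) ⟨q, hqU, rfl⟩ fun x hx z hz hxz => ⟨hz, ?_⟩
    have h1 := hb x
    rw [Pi.sub_apply, bd_of_notMem hx.1] at h1
    simp only [Pi.zero_apply] at h1
    rw [← hx.2]
    exact eq_of_lap_nonpos_of_isMax (fun w => by rw [hx.2]; exact hmax w) (by omega) hxz
  have hconst : σ = fun _ => σ q := by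
    ext v
    by_cases hv : v ∈ U
    · rw [← hYU] at hv
      exact hv.2
    · exact (hout hv).2
  refine ⟨by rw [hconst, lap_const, sub_zero], ?_⟩
  rw [← hYU]
  ext v
  simp only [Set.mem_ofPred_eq, iff_self_and]
  intro _
  rw [hconst]

open Classical in
/-- Equivalent effective divisors with a common support vertex are on the same side of a cut. -/
lemma farSide_of_common_support {q : V} {U : Set V} (hU : Conn m U) (hU' : Conn m Uᶜ)
    (hqU : q ∉ U) {a σ : V → ℤ} (ha : 0 ≤ a) (hb : 0 ≤ a - lap m σ) {v : V} (hav : 0 < a v)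
    (hbv : 0 < (a - lap m σ) v) (hP : FarSide m q U a) : FarSide m q U (a - lap m σ) := by
  have hsingle : ∀ c : V → ℤ, 0 ≤ c → 0 < c v → 0 ≤ c - Pi.single v 1 := fun c hc hcv w => by
    by_cases hw : w = v
    · subst hw
      simp only [Pi.zero_apply, Pi.sub_apply, Pi.single_eq_same]
      omega
    · simpa [hw] using hc w
  have heq : a - lap m σ - Pi.single v 1 = a - Pi.single v 1 - lap m σ := by abel
  -- Remove the common chip at `v`, join the remainders by legal firings, and put the chip back:
  -- every divisor along the way has a chip at `v`. A firing that leaves the far side would go from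
  -- `bd m U` to `bd m Uᶜ`, whose supports are disjoint.
  have key := chain_induction (m := m) (σ := σ) (a := a - Pi.single v 1)
    (R := fun c c' => FarSide m q U (c + Pi.single v 1) → FarSide m q U (c' + Pi.single v 1))
    (fun _ _ h => h) (fun _ _ _ h h' hh => h' (h hh)) ?_ (hsingle a ha hav)
    (heq ▸ hsingle _ hb hbv)
  · simp only [sub_add_cancel, ← heq] at key
    exact key hP
  intro c Y hc hc' hPc
  by_contra hN
  have hs : 0 ≤ (Pi.single v 1 : V → ℤ) := Pi.single_nonneg.2 zero_le_one
  have heq' : c - lap m (ind Y) + Pi.single v 1 = c + Pi.single v 1 - lap m (ind Y) := by abel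
  have hnn := add_nonneg hc' hs
  rw [heq'] at hN hnn
  obtain ⟨h1, rfl⟩ := eq_of_leave_farSide hU hU' hqU (add_nonneg hc hs) hnn hPc hN
  have h2 : 0 < bd m Y v := by
    have := hc v
    rw [← h1]
    simp only [Pi.zero_apply, Pi.add_apply, Pi.single_eq_same] at *
    omega
  have h3 : 0 < bd m Yᶜ v := by
    have := hc' v
    rw [← bd_compl_eq, ← h1, ← heq']
    simp only [Pi.zero_apply, Pi.add_apply, Pi.single_eq_same] at *
    omega
  exact bd_disjoint Y h2 h3

/-- Firing a different cut does not change the side. -/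
lemma farSide_bd_iff {q : V} {U W : Set V} (hU : Conn m U) (hU' : Conn m Uᶜ)
    (hqU : q ∉ U) (hqW : q ∉ W) (hne : W ≠ U) :
    FarSide m q U (bd m W) ↔ FarSide m q U (bd m Wᶜ) := by
  constructor
  · intro hP
    by_contra hN
    rw [← bd_compl_eq] at hN
    exact hne (eq_of_leave_farSide hU hU' hqU (bd_nonneg W)
      (by rw [bd_compl_eq]; exact bd_nonneg _) hP hN).2
  · rintro ⟨σ, hσ, hmax⟩
    refine ⟨σ - ind W, ?_, fun v => ?_⟩
    · rw [map_sub, ← sub_add, ← hσ, ← bd_compl_eq, sub_add_cancel]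
    · have h1 := hmax v
      have h2 := ind_nonneg W v
      rw [Pi.sub_apply, Pi.sub_apply, ind_of_notMem hqW]
      omega

end ChipFiring

/-! ### Existence of minimal graded free resolutions -/

namespace MvPolynomial

variable {σ A : Type*} [AddCommGroup A] {w : σ → A}

lemma mem_span_range_X_iff {f : MvPolynomial σ ℂ} :
    f ∈ Ideal.span (Set.range (X : σ → MvPolynomial σ ℂ)) ↔ coeff 0 f = 0 := by
  have := mem_pow_idealOfVars_iff' 1 f
  rw [pow_one] at this
  rw [this]
  simp [Finsupp.degree_eq_zero_iff]

lemma weightedHomogeneousComponent_mul_right {g : MvPolynomial σ ℂ} {e : A}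
    (hg : IsWeightedHomogeneous w g e) (n : A) (f : MvPolynomial σ ℂ) :
    weightedHomogeneousComponent w n (f * g) = weightedHomogeneousComponent w (n - e) f * g := by
  classical
  induction f using MvPolynomial.induction_on' with
  | monomial a r =>
    have h1 := isWeightedHomogeneous_monomial w a r rfl
    rw [weightedHomogeneousComponent_of_mem (h1.mul hg), weightedHomogeneousComponent_of_mem h1]
    simp only [sub_eq_iff_eq_add]
    split_ifs <;> simp
  | add p q hp hq => rw [add_mul, map_add, hp, hq, map_add, add_mul]

/-- Positivity of the grading, in the form needed for Nakayama-type arguments: coefficients of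
degree zero are scalars, hence zero or invertible. -/
lemma weightedHomogeneousComponent_zero_eq_C (hw : ∀ a : σ →₀ ℕ, Finsupp.weight w a = 0 → a = 0)
    (f : MvPolynomial σ ℂ) : weightedHomogeneousComponent w 0 f = C (coeff 0 f) := by
  classical
  ext d
  rw [coeff_weightedHomogeneousComponent, coeff_C]
  by_cases hd : d = 0
  · subst hd
    simp
  · rw [if_neg (fun h => hd (hw d h)), if_neg (fun h => hd h.symm)]

/-! ### Graded submodules and their minimal generators -/

variable (w) in
/-- The component of degree `D` of an element of the free module with basis degrees `δ`. -/
def vectorComponent {ι : Type*} (δ : ι → A) (D : A) (x : ι → MvPolynomial σ ℂ) :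
    ι → MvPolynomial σ ℂ :=
  fun i => weightedHomogeneousComponent w (D - δ i) (x i)

variable (w) in
/-- Homogeneity of degree `D` in the free module with basis degrees `δ`. -/
def IsHomogeneousVector {ι : Type*} (δ : ι → A) (D : A) (x : ι → MvPolynomial σ ℂ) : Prop :=
  ∀ i, IsWeightedHomogeneous w (x i) (D - δ i)

variable (w) in
/-- A graded submodule of the free module with basis degrees `δ`. -/
def IsGradedSubmodule {ι : Type*} (δ : ι → A)
    (K : Submodule (MvPolynomial σ ℂ) (ι → MvPolynomial σ ℂ)) : Prop :=
  ∀ x ∈ K, ∀ D, vectorComponent w δ D x ∈ K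

lemma vectorComponent_sum {ι κ : Type*} [Fintype κ] {δ : ι → A} {ε : κ → A}
    {g : κ → ι → MvPolynomial σ ℂ} (hg : ∀ j, IsHomogeneousVector w δ (ε j) (g j)) (D : A)
    (c : κ → MvPolynomial σ ℂ) :
    vectorComponent w δ D (∑ j, c j • g j) = ∑ j, vectorComponent w ε D c j • g j := by
  ext1 i
  simp only [vectorComponent, Finset.sum_apply, Pi.smul_apply, smul_eq_mul, map_sum]
  refine Finset.sum_congr rfl fun j _ => ?_
  rw [weightedHomogeneousComponent_mul_right (hg j i), sub_sub_sub_cancel_right]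

lemma exists_eq_sum_vectorComponent {ι : Type*} [Fintype ι] (δ : ι → A)
    (x : ι → MvPolynomial σ ℂ) : ∃ T : Finset A, x = ∑ D ∈ T, vectorComponent w δ D x := by
  classical
  refine ⟨Finset.univ.biUnion fun i => (x i).support.image fun d => Finsupp.weight w d + δ i, ?_⟩
  ext i d
  simp only [Finset.sum_apply, coeff_sum, vectorComponent, coeff_weightedHomogeneousComponent,
    eq_sub_iff_add_eq]
  rw [Finset.sum_ite_eq]
  split_ifs with h
  · rfl
  · by_contra hne
    exact h (Finset.mem_biUnion.2 ⟨i, Finset.mem_univ _, Finset.mem_image.2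
      ⟨d, mem_support_iff.2 hne, rfl⟩⟩)

lemma IsGradedSubmodule.span_eq {ι : Type*} [Fintype ι] {δ : ι → A}
    {K : Submodule (MvPolynomial σ ℂ) (ι → MvPolynomial σ ℂ)} (hK : IsGradedSubmodule w δ K) :
    Submodule.span (MvPolynomial σ ℂ) {x | x ∈ K ∧ ∃ D, IsHomogeneousVector w δ D x} = K := by
  refine le_antisymm (Submodule.span_le.2 fun x hx => hx.1) fun x hx => ?_
  obtain ⟨T, hT⟩ := exists_eq_sum_vectorComponent (w := w) δ x
  rw [hT]
  exact Submodule.sum_mem _ fun D _ => Submodule.subset_span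
    ⟨hK x hx D, D, fun i => weightedHomogeneousComponent_isWeightedHomogeneous _ _⟩

/-- A graded submodule has a homogeneous generating family all of whose relations have
coefficients in the ideal of the variables. -/
lemma IsGradedSubmodule.exists_minimal_generators [Finite σ]
    (hw : ∀ a : σ →₀ ℕ, Finsupp.weight w a = 0 → a = 0) {ι : Type*} [Fintype ι] {δ : ι → A}
    {K : Submodule (MvPolynomial σ ℂ) (ι → MvPolynomial σ ℂ)} (hK : IsGradedSubmodule w δ K) :
    ∃ (r : ℕ) (ε : Fin r → A) (g : Fin r → ι → MvPolynomial σ ℂ),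
      (∀ j, IsHomogeneousVector w δ (ε j) (g j)) ∧
      Submodule.span (MvPolynomial σ ℂ) (Set.range g) = K ∧
      ∀ c : Fin r → MvPolynomial σ ℂ, ∑ j, c j • g j = 0 →
        ∀ j, c j ∈ Ideal.span (Set.range (X : σ → MvPolynomial σ ℂ)) := by
  classical
  -- A homogeneous generating family of least cardinality does the job.
  let Q : ℕ → Prop := fun r => ∃ (ε : Fin r → A) (g : Fin r → ι → MvPolynomial σ ℂ),
      (∀ j, IsHomogeneousVector w δ (ε j) (g j)) ∧
      Submodule.span (MvPolynomial σ ℂ) (Set.range g) = K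
  have hex : ∃ r, Q r := by
    obtain ⟨s, hs, hspan⟩ := (Submodule.fg_span_iff_fg_span_finset_subset _).1
      (IsNoetherian.noetherian (Submodule.span (MvPolynomial σ ℂ)
        {x | x ∈ K ∧ ∃ D, IsHomogeneousVector w δ D x}))
    rw [hK.span_eq] at hspan
    have hh : ∀ x : s, ∃ D, IsHomogeneousVector w δ D x.1 := fun x => (hs x.2).2
    choose D hD using hh
    refine ⟨s.card, fun j => D (s.equivFin.symm j), fun j => (s.equivFin.symm j).1,
      fun j => hD _, ?_⟩
    rw [hspan]
    congr 1
    ext x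
    constructor
    · rintro ⟨j, rfl⟩
      exact (s.equivFin.symm j).2
    · intro hx
      exact ⟨s.equivFin ⟨x, hx⟩, by simp⟩
  obtain ⟨ε, g, hg, hspan⟩ := Nat.find_spec hex
  refine ⟨Nat.find hex, ε, g, hg, hspan, fun c hc j₀ => ?_⟩
  rw [mem_span_range_X_iff]
  by_contra hne
  have hmin : ∀ r' < Nat.find hex, ¬ Q r' := fun r' => Nat.find_min hex
  generalize Nat.find hex = r at *
  obtain ⟨r, rfl⟩ : ∃ k, r = k + 1 := Nat.exists_eq_succ_of_ne_zero fun h => by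
    subst h
    exact j₀.elim0
  refine hmin r r.lt_succ_self ⟨ε ∘ j₀.succAbove, g ∘ j₀.succAbove, fun j => hg _, ?_⟩
  rw [← hspan]
  refine le_antisymm (Submodule.span_mono (Set.range_comp_subset_range _ _))
    (Submodule.span_le.2 ?_)
  have hmem : ∀ j, g (j₀.succAbove j) ∈
      Submodule.span (MvPolynomial σ ℂ) (Set.range (g ∘ j₀.succAbove)) :=
    fun j => Submodule.subset_span ⟨j, rfl⟩
  rintro _ ⟨j, rfl⟩
  rcases eq_or_ne j j₀ with rfl | hj
  -- In the degree `ε j` part of the relation the coefficient of `g j` is the constant term of `c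
  -- j`, a nonzero scalar. So `g j` is redundant, against the minimality of the cardinality.
  · have h0 := vectorComponent_sum hg (ε j) c
    have hz : vectorComponent w δ (ε j) (∑ i, c i • g i) = 0 := by
      rw [hc]
      ext1 i
      simp [vectorComponent]
    rw [hz, Fin.sum_univ_succAbove _ j] at h0
    have h1 : vectorComponent w ε (ε j) c j = C (coeff 0 (c j)) := by
      rw [vectorComponent, sub_self, weightedHomogeneousComponent_zero_eq_C hw]
    rw [h1] at h0
    have h2 : g j = (C (coeff 0 (c j))⁻¹ : MvPolynomial σ ℂ) •
        (C (coeff 0 (c j)) : MvPolynomial σ ℂ) • g j := by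
      rw [smul_smul, ← C_mul, inv_mul_cancel₀ hne, C_1, one_smul]
    rw [SetLike.mem_coe, h2, eq_neg_of_add_eq_zero_left h0.symm]
    exact Submodule.smul_mem _ _ (Submodule.neg_mem _ (Submodule.sum_mem _ fun i _ =>
      Submodule.smul_mem _ _ (hmem i)))
  · obtain ⟨i, rfl⟩ := Fin.exists_succAbove_eq hj
    exact hmem i

end MvPolynomial

namespace MinimalFreeResolution

open MvPolynomial

/-- A graded submodule, contained in the maximal ideal times the ambient module, of a free module
of finite rank. The syzygy modules of a minimal resolution are of this form. -/
structure Syzygy {σ A : Type*} [AddCommGroup A] (w : σ → A) where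
  rank : ℕ
  deg : Fin rank → A
  K : Submodule (MvPolynomial σ ℂ) (Fin rank → MvPolynomial σ ℂ)
  graded : IsGradedSubmodule w deg K
  mem_maximal : ∀ x ∈ K, ∀ i, x i ∈ Ideal.span (Set.range (X : σ → MvPolynomial σ ℂ))

namespace Syzygy

variable {σ A : Type*} [AddCommGroup A] {w : σ → A}

/-- A map from a free module onto a syzygy module whose kernel is again a syzygy module. -/
structure Cover (s : Syzygy w) where
  next : Syzygy w
  map : (Fin next.rank → MvPolynomial σ ℂ) →ₗ[MvPolynomial σ ℂ] (Fin s.rank → MvPolynomial σ ℂ)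
  range_map : LinearMap.range map = s.K
  ker_map : LinearMap.ker map = next.K
  homogeneous : ∀ j, IsHomogeneousVector w s.deg (next.deg j) (map (Pi.single j 1))

lemma nonempty_cover [Finite σ] (hw : ∀ a : σ →₀ ℕ, Finsupp.weight w a = 0 → a = 0)
    (s : Syzygy w) : Nonempty (Cover s) := by
  obtain ⟨r, ε, g, hg, hspan, hrel⟩ := s.graded.exists_minimal_generators hw
  refine ⟨⟨⟨r, ε, LinearMap.ker (Fintype.linearCombination (MvPolynomial σ ℂ) g), ?_, ?_⟩,
    Fintype.linearCombination (MvPolynomial σ ℂ) g, ?_, rfl, ?_⟩⟩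
  · intro x hx D
    rw [LinearMap.mem_ker, Fintype.linearCombination_apply] at *
    rw [← vectorComponent_sum hg, hx]
    ext1 i
    simp [vectorComponent]
  · intro x hx
    rw [LinearMap.mem_ker, Fintype.linearCombination_apply] at hx
    exact hrel x hx
  · rw [Fintype.range_linearCombination, hspan]
  · intro j
    simpa using hg j

end Syzygy

variable {σ A : Type*} [AddCommGroup A] {w : σ → A}

theorem nonempty_of_homogeneous [Finite σ] (hw : ∀ a : σ →₀ ℕ, Finsupp.weight w a = 0 → a = 0)
    {I : Ideal (MvPolynomial σ ℂ)} (hI : ∀ f ∈ I, ∀ D, weightedHomogeneousComponent w D f ∈ I)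
    (hI' : I ≤ Ideal.span (Set.range (X : σ → MvPolynomial σ ℂ))) :
    Nonempty (MinimalFreeResolution w I) := by
  let cover : ∀ s : Syzygy w, Syzygy.Cover s := fun s => (s.nonempty_cover hw).some
  -- The resolution starts with `I` inside one copy of the ring, generated in degree 0, and iterates
  -- the choice of minimal covers.
  let s₀ : Syzygy w :=
    { rank := 1
      deg := fun _ => 0
      K := Submodule.comap (LinearMap.proj 0) I
      graded := fun x hx D => hI _ hx _
      mem_maximal := fun x hx i => by
        rw [Subsingleton.elim i 0]
        exact hI' hx }
  let seq : ℕ → Syzygy w := fun n => Nat.rec s₀ (fun _ s => (cover s).next) n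
  exact ⟨{
    rank := fun i => (seq i).rank
    deg := fun i => (seq i).deg
    d := fun i => (cover (seq i)).map
    aug := (Submodule.mkQ I) ∘ₗ (LinearMap.proj (0 : Fin 1))
    aug_surjective := by
      intro y
      obtain ⟨p, rfl⟩ := Ideal.Quotient.mk_surjective y
      exact ⟨fun _ => p, rfl⟩
    exact_aug := by
      refine LinearMap.exact_iff.2 ?_
      rw [(cover (seq 0)).range_map, LinearMap.ker_comp, Submodule.ker_mkQ]
      rfl
    exact_d := fun i => by
      refine LinearMap.exact_iff.2 ?_
      rw [(cover (seq (i + 1))).range_map, (cover (seq i)).ker_map]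
    homogeneous_d := fun i j j' => (cover (seq i)).homogeneous j j'
    homogeneous_aug := fun j => ⟨1, isWeightedHomogeneous_one ℂ w, by
      rw [Subsingleton.elim (α := Fin 1) j 0]
      simp [s₀, seq]⟩
    minimal := fun i j j' => (seq i).mem_maximal _ (by
      rw [← (cover (seq i)).range_map]
      exact LinearMap.mem_range_self _ _) j' }⟩

end MinimalFreeResolution

/-! ### Dimensions of subquotients -/

section Subquotient

/-- Independence and spanning modulo `B` are stated in the ambient space, where they can be checked
on polynomials. -/
lemma finrank_subquotient_eq_card {E T : Type*} [AddCommGroup E] [Module ℂ E] [Fintype T]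
    {K B : Submodule ℂ E} (y : T → E) (hy : ∀ t, y t ∈ K)
    (hli : ∀ c : T → ℂ, ∑ t, c t • y t ∈ B → c = 0)
    (hspan : ∀ x ∈ K, ∃ c : T → ℂ, x - ∑ t, c t • y t ∈ B) :
    Module.finrank ℂ (K ⧸ B.submoduleOf K) = Fintype.card T := by
  let Φ : (T → ℂ) →ₗ[ℂ] K ⧸ B.submoduleOf K :=
    (B.submoduleOf K).mkQ ∘ₗ Fintype.linearCombination ℂ fun t => (⟨y t, hy t⟩ : K)
  have hcoe : ∀ c : T → ℂ, ((∑ t, c t • (⟨y t, hy t⟩ : K) : K) : E) = ∑ t, c t • y t := by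
    intro c
    simp
  have hinj : Function.Injective Φ := by
    refine (injective_iff_map_eq_zero Φ).2 fun c hc => hli c ?_
    have h1 : (Submodule.Quotient.mk (∑ t, c t • (⟨y t, hy t⟩ : K)) :
      K ⧸ B.submoduleOf K) = 0 := hc
    rw [Submodule.Quotient.mk_eq_zero, Submodule.submoduleOf, Submodule.mem_comap,
      Submodule.subtype_apply, hcoe] at h1
    exact h1
  have hsurj : Function.Surjective Φ := by
    intro z
    obtain ⟨x, rfl⟩ := Submodule.Quotient.mk_surjective _ z
    obtain ⟨c, hc⟩ := hspan x x.2
    refine ⟨c, Eq.symm ((Submodule.Quotient.eq _).2 ?_)⟩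
    rw [Submodule.submoduleOf, Submodule.mem_comap, Submodule.subtype_apply,
      AddSubgroupClass.coe_sub, Fintype.linearCombination_apply, hcoe]
    exact hc
  rw [← (LinearEquiv.ofBijective Φ ⟨hinj, hsurj⟩).finrank_eq, Module.finrank_fintype_fun_eq_card]

/-- The maps need only be mutually inverse modulo `B` and `B'`, so they may depend on arbitrary
choices. -/
lemma finrank_subquotient_eq_of_inverse {E E' : Type*} [AddCommGroup E] [Module ℂ E]
    [AddCommGroup E'] [Module ℂ E'] {K B : Submodule ℂ E} {K' B' : Submodule ℂ E'}
    (f : E →ₗ[ℂ] E') (g : E' →ₗ[ℂ] E) (hfK : ∀ x ∈ K, f x ∈ K') (hfB : ∀ x ∈ B, f x ∈ B')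
    (hgK : ∀ x ∈ K', g x ∈ K) (hgB : ∀ x ∈ B', g x ∈ B) (hgf : ∀ x ∈ K, g (f x) - x ∈ B)
    (hfg : ∀ x ∈ K', f (g x) - x ∈ B') :
    Module.finrank ℂ (K ⧸ B.submoduleOf K) = Module.finrank ℂ (K' ⧸ B'.submoduleOf K') := by
  let f' : (K ⧸ B.submoduleOf K) →ₗ[ℂ] (K' ⧸ B'.submoduleOf K') :=
    Submodule.mapQ _ _ (f.restrict hfK) fun x hx => hfB _ hx
  let g' : (K' ⧸ B'.submoduleOf K') →ₗ[ℂ] (K ⧸ B.submoduleOf K) :=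
    Submodule.mapQ _ _ (g.restrict hgK) fun x hx => hgB _ hx
  refine (LinearEquiv.ofLinearMap f' g' ?_ ?_).finrank_eq
  · refine LinearMap.ext fun z => ?_
    obtain ⟨x, rfl⟩ := Submodule.Quotient.mk_surjective _ z
    exact (Submodule.Quotient.eq _).2 (hfg x x.2)
  · refine LinearMap.ext fun z => ?_
    obtain ⟨x, rfl⟩ := Submodule.Quotient.mk_surjective _ z
    exact (Submodule.Quotient.eq _).2 (hgf x x.2)

end Subquotient

/-! ### The first Betti numbers count minimal generators -/

namespace MinimalFreeResolution

open MvPolynomial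

variable {σ A : Type*} [AddCommGroup A] {w : σ → A} {I : Ideal (MvPolynomial σ ℂ)}

lemma mem_maximal_of_aug_eq_zero (F : MinimalFreeResolution w I)
    {x : Fin (F.rank 0) → MvPolynomial σ ℂ} (hx : F.aug x = 0) (i : Fin (F.rank 0)) :
    x i ∈ Ideal.span (Set.range (X : σ → MvPolynomial σ ℂ)) := by
  obtain ⟨y, rfl⟩ := (F.exact_aug x).1 hx
  rw [pi_eq_sum_univ' y, map_sum, Finset.sum_apply]
  refine Ideal.sum_mem _ fun j _ => ?_
  rw [map_smul, Pi.smul_apply, smul_eq_mul]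
  convert Ideal.mul_mem_left _ _ (F.minimal 0 j i) using 4

lemma mem_maximal_of_d_eq_zero (F : MinimalFreeResolution w I) (n : ℕ)
    {x : Fin (F.rank (n + 1)) → MvPolynomial σ ℂ} (hx : F.d n x = 0) (i : Fin (F.rank (n + 1))) :
    x i ∈ Ideal.span (Set.range (X : σ → MvPolynomial σ ℂ)) := by
  obtain ⟨y, rfl⟩ := (F.exact_d n x).1 hx
  rw [pi_eq_sum_univ' y, map_sum, Finset.sum_apply]
  refine Ideal.sum_mem _ fun j _ => ?_
  rw [map_smul, Pi.smul_apply, smul_eq_mul]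
  convert Ideal.mul_mem_left _ _ (F.minimal (n + 1) j i) using 4

/-- The images of the basis elements of `F₁` form a minimal system of generators of `I`. -/
lemma exists_generators (F : MinimalFreeResolution w I)
    (hI : I ≤ Ideal.span (Set.range (X : σ → MvPolynomial σ ℂ))) :
    ∃ g : Fin (F.rank 1) → MvPolynomial σ ℂ,
      (∀ j, IsWeightedHomogeneous w (g j) (F.deg 1 j)) ∧ Ideal.span (Set.range g) = I ∧
      ∀ c : Fin (F.rank 1) → MvPolynomial σ ℂ, ∑ j, c j * g j = 0 →
        ∀ j, c j ∈ Ideal.span (Set.range (X : σ → MvPolynomial σ ℂ)) := by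
  choose p hp haug using F.homogeneous_aug
  have haug' : ∀ x, F.aug x = Ideal.Quotient.mk I (∑ j, x j * p j) := fun x => by
    conv_lhs => rw [← Finset.univ_sum_single x]
    rw [map_sum, map_sum]
    refine Finset.sum_congr rfl fun j _ => ?_
    have : (Pi.single j (x j) : Fin (F.rank 0) → MvPolynomial σ ℂ) = x j • Pi.single j 1 := by
      rw [← Pi.single_smul, smul_eq_mul, mul_one]
    rw [this, map_smul, haug, map_mul]
    rfl
  obtain ⟨u, hu⟩ := F.aug_surjective 1
  rw [haug', ← map_one (Ideal.Quotient.mk I), Ideal.Quotient.eq] at hu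
  -- Otherwise `1` would lie in `𝔪 + I = 𝔪`.
  have hex : ∃ j₀, coeff 0 (p j₀) ≠ 0 := by
    by_contra hc
    push Not at hc
    have h1 : ∑ j, u j * p j ∈ Ideal.span (Set.range (X : σ → MvPolynomial σ ℂ)) :=
      Ideal.sum_mem _ fun j _ => Ideal.mul_mem_left _ _ (mem_span_range_X_iff.2 (hc j))
    have h2 := Ideal.sub_mem _ h1 (hI hu)
    rw [sub_sub_cancel, mem_span_range_X_iff] at h2
    simp at h2
  obtain ⟨j₀, hj₀⟩ := hex
  -- For `j ≠ j₀` the Koszul relation `p j₀ • e_j - p j • e_{j₀}` lies in the kernel of `aug`. By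
  -- minimality its coordinates lie in 𝔪, but `p j₀` has a nonzero constant term.
  have huniq : ∀ j, j = j₀ := by
    intro j
    by_contra hne
    have h0 : F.aug (Pi.single j (p j₀) - Pi.single j₀ (p j)) = 0 := by
      rw [haug', Ideal.Quotient.eq_zero_iff_mem]
      convert I.zero_mem using 1
      simp only [Pi.sub_apply, Pi.single_apply, sub_mul, ite_mul, zero_mul,
        Finset.sum_sub_distrib, Finset.sum_ite_eq', Finset.mem_univ, if_true]
      ring
    have h1 := mem_maximal_of_aug_eq_zero F h0 j
    rw [mem_span_range_X_iff] at h1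
    simp [hne, hj₀] at h1
  have hsum : ∀ f : Fin (F.rank 0) → MvPolynomial σ ℂ, ∑ j, f j = f j₀ := fun f =>
    Finset.sum_eq_single j₀ (fun j _ h => absurd (huniq j) h) (by simp)
  have hdeg : F.deg 0 j₀ = 0 := by
    rw [← hp j₀ hj₀, map_zero]
  -- `p j₀` is invertible modulo `I`, with inverse `u j₀`.
  have hker : ∀ x, F.aug x = 0 ↔ x j₀ ∈ I := fun x => by
    rw [haug', Ideal.Quotient.eq_zero_iff_mem, hsum]
    refine ⟨fun h => ?_, fun h => Ideal.mul_mem_right _ _ h⟩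
    rw [hsum] at hu
    have h2 := Ideal.sub_mem _ (Ideal.mul_mem_left _ (u j₀) h) (Ideal.mul_mem_left _ (x j₀) hu)
    convert h2 using 1
    ring
  have hd : ∀ c : Fin (F.rank 1) → MvPolynomial σ ℂ,
      F.d 0 c j₀ = ∑ j, c j * F.d 0 (Pi.single j 1) j₀ := fun c => by
    conv_lhs => rw [← Finset.univ_sum_single c]
    rw [map_sum, Finset.sum_apply]
    refine Finset.sum_congr rfl fun j _ => ?_
    have : (Pi.single j (c j) : Fin (F.rank 1) → MvPolynomial σ ℂ) = c j • Pi.single j 1 := by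
      rw [← Pi.single_smul, smul_eq_mul, mul_one]
    rw [this, map_smul, Pi.smul_apply, smul_eq_mul]
  refine ⟨fun j => F.d 0 (Pi.single j 1) j₀, fun j => ?_, le_antisymm ?_ ?_, fun c hc j => ?_⟩
  · simpa [hdeg] using F.homogeneous_d 0 j j₀
  · rw [Ideal.span_le]
    rintro _ ⟨j, rfl⟩
    exact (hker _).1 ((F.exact_aug _).2 ⟨_, rfl⟩)
  · intro f hf
    obtain ⟨c, hc⟩ := (F.exact_aug (fun _ => f)).1 ((hker _).2 hf)
    rw [Ideal.mem_span_range_iff_exists_fun]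
    exact ⟨c, by rw [← hd, hc]⟩
  · refine mem_maximal_of_d_eq_zero F 0 (funext fun i => ?_) j
    rw [huniq i, hd]
    exact hc

/-- The first fine Betti numbers are the dimensions of the graded pieces of `I ⧸ 𝔪 I`. -/
theorem betti_one_eq_finrank (F : MinimalFreeResolution w I)
    (hI : I ≤ Ideal.span (Set.range (X : σ → MvPolynomial σ ℂ)))
    (hmul : ∀ f ∈ Ideal.span (Set.range (X : σ → MvPolynomial σ ℂ)) * I, ∀ D,
      weightedHomogeneousComponent w D f ∈
        Ideal.span (Set.range (X : σ → MvPolynomial σ ℂ)) * I) (D : A) :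
    F.betti 1 D = Module.finrank ℂ
      (↥(weightedHomogeneousSubmodule ℂ w D ⊓ I.restrictScalars ℂ) ⧸
        (weightedHomogeneousSubmodule ℂ w D ⊓
          (Ideal.span (Set.range (X : σ → MvPolynomial σ ℂ)) * I).restrictScalars ℂ).submoduleOf
            (weightedHomogeneousSubmodule ℂ w D ⊓ I.restrictScalars ℂ)) := by
  classical
  obtain ⟨g, hg, hspan, hrel⟩ := F.exists_generators hI
  have hgI : ∀ j, g j ∈ I := fun j => hspan ▸ Ideal.subset_span ⟨j, rfl⟩
  have hsub : ∀ f : Fin (F.rank 1) → MvPolynomial σ ℂ, (∀ j, F.deg 1 j ≠ D → f j = 0) →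
      ∑ j, f j = ∑ t : {j // F.deg 1 j = D}, f t := fun f hf => by
    rw [← Finset.sum_subtype (Finset.univ.filter fun j => F.deg 1 j = D) (by simp) f,
      Finset.sum_filter_of_ne fun j _ h => not_not.1 fun hj => h (hf j hj)]
  rw [finrank_subquotient_eq_card (T := {j // F.deg 1 j = D}) (fun j => g j)]
  · rw [betti, ← Nat.card_coe_set_eq, ← Nat.card_eq_fintype_card]
    rfl
  · rintro ⟨j, rfl⟩
    exact ⟨hg j, hgI j⟩
  · intro c hc
    have hmulI : Ideal.span (Set.range (X : σ → MvPolynomial σ ℂ)) * I =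
        Ideal.span (Set.range (X : σ → MvPolynomial σ ℂ)) •
          Submodule.span (MvPolynomial σ ℂ) (Set.range g) := congrArg _ hspan.symm
    have h1 : _ ∈ Ideal.span (Set.range (X : σ → MvPolynomial σ ℂ)) * I := hc.2
    rw [hmulI] at h1
    obtain ⟨a, ha, hsum⟩ := (Submodule.mem_ideal_smul_span_iff_exists_sum _ _ _).1 h1
    rw [Finsupp.sum_fintype _ _ (by simp)] at hsum
    let c' : Fin (F.rank 1) → ℂ := fun j => if h : F.deg 1 j = D then c ⟨j, h⟩ else 0
    have hc' : ∑ j, C (c' j) * g j = ∑ t : {j // F.deg 1 j = D}, c t • g t := by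
      rw [hsub _ fun j hj => by simp [c', hj]]
      refine Finset.sum_congr rfl fun t _ => ?_
      rw [← smul_eq_C_mul]
      simp [c', t.2]
    -- Subtracting an expression with coefficients `a j` in 𝔪 gives a relation among the generators.
    -- Its coefficients lie in 𝔪, so the scalars `c' j` vanish.
    have h2 := hrel (fun j => C (c' j) - a j) (by
      simp only [sub_mul, Finset.sum_sub_distrib, hc', ← hsum, smul_eq_mul, sub_self])
    funext ⟨j, hj⟩
    have h3 := Ideal.add_mem _ (h2 j) (ha j)
    rw [sub_add_cancel, mem_span_range_X_iff, coeff_zero_C] at h3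
    simpa [c', hj] using h3
  · rintro x ⟨hxD, hxI⟩
    replace hxI : x ∈ I := hxI
    rw [← hspan] at hxI
    obtain ⟨h, rfl⟩ := Ideal.mem_span_range_iff_exists_fun.1 hxI
    -- Modulo `𝔪I` only the constant terms of the coefficients matter, and the degree `D` component
    -- keeps only the generators of degree `D`.
    refine ⟨fun t => coeff 0 (h t), ?_, ?_⟩
    · exact Submodule.sub_mem _ hxD (Submodule.sum_mem _ fun t _ => Submodule.smul_mem _ _ (by
        have := hg t.1
        rwa [t.2] at this))
    · have h1 : ∑ j, h j * g j - ∑ j, C (coeff 0 (h j)) * g j ∈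
          Ideal.span (Set.range (X : σ → MvPolynomial σ ℂ)) * I := by
        rw [← Finset.sum_sub_distrib]
        refine Ideal.sum_mem _ fun j _ => ?_
        rw [← sub_mul]
        exact Ideal.mul_mem_mul (mem_span_range_X_iff.2 (by simp)) (hgI j)
      have h2 := hmul _ h1 D
      rw [map_sub, IsWeightedHomogeneous.weightedHomogeneousComponent_same hxD, map_sum] at h2
      change _ ∈ Ideal.span (Set.range (X : σ → MvPolynomial σ ℂ)) * I
      convert h2 using 2
      rw [hsub _ fun j hj => ((hg j).C_mul _).weightedHomogeneousComponent_ne D (Ne.symm hj)]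
      refine Finset.sum_congr rfl fun t _ => ?_
      have := ((hg t.1).C_mul (coeff 0 (h t))).weightedHomogeneousComponent_same
      rw [t.2] at this
      rw [this, smul_eq_C_mul]

end MinimalFreeResolution

/-! ### Lattice ideals -/

namespace MvPolynomial

variable {σ A : Type*} [AddCommGroup A] {w : σ → A}

variable (w) in
/-- The ideal generated by the binomials that are homogeneous for the grading `w`. -/
def binomialIdeal : Ideal (MvPolynomial σ ℂ) :=
  Ideal.span {p | ∃ a b : σ →₀ ℕ, Finsupp.weight w a = Finsupp.weight w b ∧
    p = monomial a 1 - monomial b 1}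

variable (w) in
/-- The span of the binomials of degree `D` whose two exponents are related by `r`. -/
def binomialSpan (r : (σ →₀ ℕ) → (σ →₀ ℕ) → Prop) (D : A) : Submodule ℂ (MvPolynomial σ ℂ) :=
  Submodule.span ℂ {p | ∃ a b : σ →₀ ℕ, Finsupp.weight w a = D ∧ Finsupp.weight w b = D ∧ r a b ∧
    p = monomial a 1 - monomial b 1}

/-- Two exponents with a common vertex in their supports. -/
def CommonSupport (a b : σ →₀ ℕ) : Prop := ∃ v, a v ≠ 0 ∧ b v ≠ 0

/-- For a set stable under multiplication by monomials the linear span is already an ideal, which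
turns ideal membership into linear algebra over `ℂ`. -/
lemma restrictScalars_ideal_span {s : Set (MvPolynomial σ ℂ)}
    (hs : ∀ a, ∀ p ∈ s, monomial a 1 * p ∈ s) :
    (Ideal.span s).restrictScalars ℂ = Submodule.span ℂ s := by
  refine le_antisymm (fun x hx => ?_) (Submodule.span_le.2 Ideal.subset_span)
  rw [Submodule.restrictScalars_mem] at hx
  induction hx using Submodule.span_induction with
  | mem x hx => exact Submodule.subset_span hx
  | zero => exact Submodule.zero_mem _
  | add x y _ _ hx hy => exact Submodule.add_mem _ hx hy
  | smul f x _ hx =>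
    have key : ∀ a : σ →₀ ℕ, ∀ y ∈ Submodule.span ℂ s, monomial a 1 * y ∈ Submodule.span ℂ s := by
      intro a y hy
      induction hy using Submodule.span_induction with
      | mem x hx => exact Submodule.subset_span (hs a x hx)
      | zero => simp
      | add x y _ _ hx hy => rw [mul_add]; exact Submodule.add_mem _ hx hy
      | smul c x _ hx => rw [mul_smul_comm]; exact Submodule.smul_mem _ _ hx
    rw [smul_eq_mul]
    induction f using MvPolynomial.induction_on' with
    | monomial a r =>
      rw [← mul_one r, ← smul_eq_mul r, ← smul_monomial, smul_mul_assoc]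
      exact Submodule.smul_mem _ _ (key a x hx)
    | add p q hp hq => rw [add_mul]; exact Submodule.add_mem _ hp hq

lemma component_mem_binomialSpan {r : (σ →₀ ℕ) → (σ →₀ ℕ) → Prop} {f : MvPolynomial σ ℂ}
    (hf : f ∈ Submodule.span ℂ {p | ∃ a b : σ →₀ ℕ, Finsupp.weight w a = Finsupp.weight w b ∧
      r a b ∧ p = monomial a 1 - monomial b 1}) (D : A) :
    weightedHomogeneousComponent w D f ∈ binomialSpan w r D := by
  classical
  induction hf using Submodule.span_induction with
  | mem x hx =>
    obtain ⟨a, b, hab, hr, rfl⟩ := hx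
    rw [map_sub, weightedHomogeneousComponent_of_mem (isWeightedHomogeneous_monomial w a 1 rfl),
      weightedHomogeneousComponent_of_mem (isWeightedHomogeneous_monomial w b 1 rfl), ← hab]
    split_ifs with h
    · exact Submodule.subset_span ⟨a, b, h.symm, (h.trans hab).symm, hr, rfl⟩
    · simp
  | zero => simp
  | add x y _ _ hx hy => rw [map_add]; exact Submodule.add_mem _ hx hy
  | smul c x _ hx => rw [map_smul]; exact Submodule.smul_mem _ _ hx

lemma weightedHomogeneousSubmodule_inf_span (r : (σ →₀ ℕ) → (σ →₀ ℕ) → Prop) (D : A) :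
    weightedHomogeneousSubmodule ℂ w D ⊓
      Submodule.span ℂ {p | ∃ a b : σ →₀ ℕ, Finsupp.weight w a = Finsupp.weight w b ∧
        r a b ∧ p = monomial a 1 - monomial b 1} = binomialSpan w r D := by
  refine le_antisymm ?_ (Submodule.span_le.2 ?_)
  · rintro x ⟨hxD, hx⟩
    have := component_mem_binomialSpan hx D
    rwa [IsWeightedHomogeneous.weightedHomogeneousComponent_same hxD] at this
  · rintro _ ⟨a, b, ha, hb, hr, rfl⟩
    exact ⟨(isWeightedHomogeneous_monomial w a 1 ha).sub (isWeightedHomogeneous_monomial w b 1 hb),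
      Submodule.subset_span ⟨a, b, ha.trans hb.symm, hr, rfl⟩⟩

lemma restrictScalars_binomialIdeal : (binomialIdeal w).restrictScalars ℂ =
    Submodule.span ℂ {p | ∃ a b : σ →₀ ℕ, Finsupp.weight w a = Finsupp.weight w b ∧
      True ∧ p = monomial a 1 - monomial b 1} := by
  simp only [true_and]
  refine restrictScalars_ideal_span ?_
  rintro c _ ⟨a, b, h, rfl⟩
  exact ⟨c + a, c + b, by rw [map_add, map_add, h], by simp [mul_sub, monomial_mul]⟩

/-- Multiplying a binomial by `x_v` puts `v` into both supports. Conversely a common variable can be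
divided out, because its weight cancels in the group `A`. -/
lemma restrictScalars_maximal_mul_binomialIdeal :
    (Ideal.span (Set.range (X : σ → MvPolynomial σ ℂ)) * binomialIdeal w).restrictScalars ℂ =
    Submodule.span ℂ {p | ∃ a b : σ →₀ ℕ, Finsupp.weight w a = Finsupp.weight w b ∧
      CommonSupport a b ∧ p = monomial a 1 - monomial b 1} := by
  rw [← restrictScalars_ideal_span]
  · congr 1
    rw [binomialIdeal, Ideal.span_mul_span']
    refine le_antisymm (Ideal.span_le.2 ?_) (Ideal.span_le.2 ?_)
    · rintro _ ⟨_, ⟨v, rfl⟩, _, ⟨a, b, h, rfl⟩, rfl⟩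
      refine Ideal.subset_span ⟨Finsupp.single v 1 + a, Finsupp.single v 1 + b,
        by rw [map_add, map_add, h], ⟨v, by simp, by simp⟩, ?_⟩
      simp [mul_sub, X, monomial_mul]
    · rintro _ ⟨a, b, h, ⟨v, hav, hbv⟩, rfl⟩
      have ha : Finsupp.single v 1 + (a - Finsupp.single v 1) = a :=
        add_tsub_cancel_of_le (Finsupp.single_le_iff.2 (Nat.one_le_iff_ne_zero.2 hav))
      have hb : Finsupp.single v 1 + (b - Finsupp.single v 1) = b :=
        add_tsub_cancel_of_le (Finsupp.single_le_iff.2 (Nat.one_le_iff_ne_zero.2 hbv))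
      refine Ideal.subset_span ⟨X v, ⟨v, rfl⟩, _, ⟨a - Finsupp.single v 1, b - Finsupp.single v 1,
        ?_, rfl⟩, ?_⟩
      · rw [← ha, ← hb, map_add, map_add] at h
        exact add_left_cancel h
      · simp [mul_sub, X, monomial_mul, ha, hb]
  · rintro c _ ⟨a, b, h, ⟨v, hav, hbv⟩, rfl⟩
    exact ⟨c + a, c + b, by rw [map_add, map_add, h], ⟨v, by simp [hav], by simp [hbv]⟩,
      by simp [mul_sub, monomial_mul]⟩

lemma component_mem_binomialIdeal (f : MvPolynomial σ ℂ) (hf : f ∈ binomialIdeal w) (D : A) :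
    weightedHomogeneousComponent w D f ∈ binomialIdeal w := by
  rw [← Submodule.restrictScalars_mem ℂ, restrictScalars_binomialIdeal] at hf
  have := component_mem_binomialSpan hf D
  rw [← weightedHomogeneousSubmodule_inf_span, ← restrictScalars_binomialIdeal] at this
  exact this.2

lemma binomialIdeal_le (hw : ∀ a : σ →₀ ℕ, Finsupp.weight w a = 0 → a = 0) :
    binomialIdeal w ≤ Ideal.span (Set.range (X : σ → MvPolynomial σ ℂ)) := by
  classical
  refine Ideal.span_le.2 ?_
  rintro _ ⟨a, b, h, rfl⟩
  rw [SetLike.mem_coe, mem_span_range_X_iff, coeff_sub, coeff_monomial, coeff_monomial]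
  by_cases ha : a = 0
  · have hb : b = 0 := hw b (by rw [← h, ha, map_zero])
    simp [ha, hb]
  · have hb : b ≠ 0 := fun hb => ha (hw a (by rw [h, hb, map_zero]))
    simp [ha, hb]

lemma betti_one_binomialIdeal (hw : ∀ a : σ →₀ ℕ, Finsupp.weight w a = 0 → a = 0)
    (F : MinimalFreeResolution w (binomialIdeal w)) (D : A) :
    F.betti 1 D = Module.finrank ℂ (binomialSpan w (fun _ _ => True) D ⧸
      (binomialSpan w CommonSupport D).submoduleOf (binomialSpan w (fun _ _ => True) D)) := by
  rw [F.betti_one_eq_finrank (binomialIdeal_le hw), restrictScalars_binomialIdeal,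
    restrictScalars_maximal_mul_binomialIdeal, weightedHomogeneousSubmodule_inf_span,
    weightedHomogeneousSubmodule_inf_span]
  intro f hf D
  rw [← Submodule.restrictScalars_mem ℂ, restrictScalars_maximal_mul_binomialIdeal] at hf
  have := component_mem_binomialSpan hf D
  rw [← weightedHomogeneousSubmodule_inf_span, ← restrictScalars_maximal_mul_binomialIdeal] at this
  exact this.2

end MvPolynomial

/-! ### Binomials and the reduced homology of the support complex -/

namespace MvPolynomial

variable {σ A : Type*} [AddCommGroup A] {w : σ → A}

open Classical in
/-- The graded pieces of the module of minimal generators of the binomial ideal are the reduced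
homology spaces of the complexes of supports. -/
theorem finrank_reducedHomologyZero_eq [Fintype σ]
    (hw : ∀ a : σ →₀ ℕ, Finsupp.weight w a = 0 → a = 0) (D : A) (Δ : Set (Finset σ))
    (hΔ : ∀ W, W ∈ Δ ↔ ∃ a : σ →₀ ℕ, Finsupp.weight w a = D ∧ W ⊆ a.support) :
    Module.finrank ℂ (ReducedHomologyZero Δ) =
      Module.finrank ℂ (binomialSpan w (fun _ _ => True) D ⧸
        (binomialSpan w CommonSupport D).submoduleOf (binomialSpan w (fun _ _ => True) D)) := by
  have hmem : ∀ (a : σ →₀ ℕ), Finsupp.weight w a = D → ∀ v, a v ≠ 0 → {v} ∈ Δ :=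
    fun a ha v hv => (hΔ _).2 ⟨a, ha, by simpa using hv⟩
  have hv : ∀ v : {v : σ // {v} ∈ Δ}, ∃ a : σ →₀ ℕ, Finsupp.weight w a = D ∧ a v.1 ≠ 0 :=
    fun v => by
      obtain ⟨a, ha, hs⟩ := (hΔ _).1 v.2
      exact ⟨a, ha, by simpa using hs⟩
  choose E hED hEv using hv
  -- The default value 0 is harmless: other degrees play no role, and by positivity the zero
  -- exponent is alone in its degree, where every binomial is zero (`hzero`).
  have hb : ∀ b : σ →₀ ℕ, ∃ x : {v : σ // {v} ∈ Δ} → ℂ, Finsupp.weight w b = D → b ≠ 0 →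
      ∃ v : {v : σ // {v} ∈ Δ}, b v.1 ≠ 0 ∧ x = Pi.single v 1 := fun b => by
    by_cases h : Finsupp.weight w b = D ∧ b ≠ 0
    · obtain ⟨v, hv⟩ := Finsupp.ne_iff.1 h.2
      exact ⟨Pi.single ⟨v, hmem b h.1 v hv⟩ 1, fun _ _ => ⟨⟨v, hmem b h.1 v hv⟩, hv, rfl⟩⟩
    · exact ⟨0, fun h1 h2 => absurd ⟨h1, h2⟩ h⟩
  choose e he using hb
  -- `f` replaces a vertex by a monomial containing it, and `g` a monomial by a vertex of its
  -- support. Two vertices of one support span an edge, and two monomials containing one vertex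
  -- differ by a common-support binomial, so the choices do not matter in the quotients.
  let f : ({v : σ // {v} ∈ Δ} → ℂ) →ₗ[ℂ] MvPolynomial σ ℂ :=
    Fintype.linearCombination ℂ fun v => monomial (E v) 1
  let g : MvPolynomial σ ℂ →ₗ[ℂ] ({v : σ // {v} ∈ Δ} → ℂ) := (basisMonomials σ ℂ).constr ℂ e
  have hf : ∀ v, f (Pi.single v 1) = monomial (E v) 1 := fun v => by
    simp [f]
  have hg : ∀ b, g (monomial b 1) = e b := fun b => by
    have := (basisMonomials σ ℂ).constr_basis ℂ e b
    rwa [coe_basisMonomials] at this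
  have haug : ∀ x, simplicialAugmentation Δ x = ∑ v, x v := fun x => by
    simp [simplicialAugmentation]
  have haug1 : ∀ v : {v : σ // {v} ∈ Δ}, simplicialAugmentation Δ (Pi.single v 1) = 1 :=
    fun v => by
      rw [haug]
      simp
  have hedge : ∀ (a : σ →₀ ℕ), Finsupp.weight w a = D → ∀ u v : {v : σ // {v} ∈ Δ},
      a u.1 ≠ 0 → a v.1 ≠ 0 →
        (Pi.single v 1 - Pi.single u 1 : {v : σ // {v} ∈ Δ} → ℂ) ∈ simplicialBoundaries Δ :=
    fun a ha u v hu hv => Submodule.subset_span ⟨u, v, (hΔ _).2 ⟨a, ha, by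
      intro x hx
      rcases Finset.mem_insert.1 hx with rfl | hx
      · simpa using hu
      · rw [Finset.mem_singleton.1 hx]
        simpa using hv⟩, rfl⟩
  have hcommon : ∀ a b : σ →₀ ℕ, Finsupp.weight w a = D → Finsupp.weight w b = D → ∀ v, a v ≠ 0 →
      b v ≠ 0 → (monomial a 1 - monomial b 1 : MvPolynomial σ ℂ) ∈ binomialSpan w CommonSupport D :=
    fun a b ha hb v hav hbv => Submodule.subset_span ⟨a, b, ha, hb, ⟨v, hav, hbv⟩, rfl⟩
  have hzero : ∀ a b : σ →₀ ℕ, Finsupp.weight w a = D → Finsupp.weight w b = D →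
      a = b ∨ (a ≠ 0 ∧ b ≠ 0) := fun a b ha hb => by
    by_cases h : a = 0
    · left
      rw [h, hw b (by rw [hb, ← ha, h, map_zero])]
    · by_cases h' : b = 0
      · left
        rw [h', hw a (by rw [ha, ← hb, h', map_zero])]
      · exact Or.inr ⟨h, h'⟩
  have hgf : ∀ x, g (f x) - x ∈ simplicialBoundaries Δ := fun x => by
    have hx : g (f x) - x = ∑ v, x v • (e (E v) - Pi.single v 1) := by
      conv_lhs => rw [pi_eq_sum_univ' x]
      simp only [map_sum, map_smul, ← Finset.sum_sub_distrib, ← smul_sub]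
      refine Finset.sum_congr rfl fun v _ => ?_
      rw [hf, hg]
    rw [hx]
    refine Submodule.sum_mem _ fun v _ => Submodule.smul_mem _ _ ?_
    obtain ⟨u, hu, hu'⟩ := he (E v) (hED v) (fun h => hEv v (by simp [h]))
    rw [hu']
    exact hedge (E v) (hED v) v u (hEv v) hu
  refine finrank_subquotient_eq_of_inverse f g ?_ ?_ ?_ ?_ (fun x _ => hgf x) ?_
  · intro x hx
    rw [LinearMap.mem_ker, haug] at hx
    rcases isEmpty_or_nonempty {v : σ // {v} ∈ Δ} with hemp | ⟨⟨v₀⟩⟩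
    · rw [Subsingleton.elim x 0, map_zero]
      exact Submodule.zero_mem _
    · have : f x = ∑ v, x v • (monomial (E v) 1 - monomial (E v₀) 1) := by
        simp only [smul_sub, Finset.sum_sub_distrib, ← Finset.sum_smul, hx, zero_smul, sub_zero]
        rfl
      rw [this]
      exact Submodule.sum_mem _ fun v _ => Submodule.smul_mem _ _
        (Submodule.subset_span ⟨_, _, hED v, hED v₀, trivial, rfl⟩)
  · intro x hx
    induction hx using Submodule.span_induction with
    | mem x hx =>
      obtain ⟨u, v, huv, rfl⟩ := hx
      obtain ⟨a, ha, hs⟩ := (hΔ _).1 huv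
      have hau : a u.1 ≠ 0 := by simpa using hs (Finset.mem_insert_self _ _)
      have hav : a v.1 ≠ 0 := by
        simpa using hs (Finset.mem_insert_of_mem (Finset.mem_singleton_self _))
      rw [map_sub, hf, hf, ← sub_add_sub_cancel _ (monomial a 1)]
      exact Submodule.add_mem _ (hcommon _ _ (hED v) ha v (hEv v) hav)
        (hcommon _ _ ha (hED u) u hau (hEv u))
    | zero => rw [map_zero]; exact Submodule.zero_mem _
    | add x y _ _ hx hy => rw [map_add]; exact Submodule.add_mem _ hx hy
    | smul c x _ hx => rw [map_smul]; exact Submodule.smul_mem _ _ hx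
  · intro x hx
    induction hx using Submodule.span_induction with
    | mem x hx =>
      obtain ⟨a, b, ha, hb, -, rfl⟩ := hx
      rcases hzero a b ha hb with rfl | ⟨ha0, hb0⟩
      · simp
      · obtain ⟨u, -, hu'⟩ := he a ha ha0
        obtain ⟨v, -, hv'⟩ := he b hb hb0
        rw [LinearMap.mem_ker, map_sub, map_sub, hg, hg, hu', hv', haug1, haug1, sub_self]
    | zero => rw [map_zero]; exact Submodule.zero_mem _
    | add x y _ _ hx hy => rw [map_add]; exact Submodule.add_mem _ hx hy
    | smul c x _ hx => rw [map_smul]; exact Submodule.smul_mem _ _ hx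
  · intro x hx
    induction hx using Submodule.span_induction with
    | mem x hx =>
      obtain ⟨a, b, ha, hb, ⟨v, hav, hbv⟩, rfl⟩ := hx
      obtain ⟨u, hu, hu'⟩ := he a ha (fun h => hav (by simp [h]))
      obtain ⟨u₂, hu₂, hu₂'⟩ := he b hb (fun h => hbv (by simp [h]))
      rw [map_sub, hg, hg, hu', hu₂', ← sub_add_sub_cancel _ (Pi.single ⟨v, hmem a ha v hav⟩ 1)]
      exact Submodule.add_mem _ (hedge a ha _ _ hav hu) (hedge b hb _ _ hu₂ hbv)
    | zero => rw [map_zero]; exact Submodule.zero_mem _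
    | add x y _ _ hx hy => rw [map_add]; exact Submodule.add_mem _ hx hy
    | smul c x _ hx => rw [map_smul]; exact Submodule.smul_mem _ _ hx
  · intro x hx
    induction hx using Submodule.span_induction with
    | mem x hx =>
      obtain ⟨a, b, ha, hb, -, rfl⟩ := hx
      rcases hzero a b ha hb with rfl | ⟨ha0, hb0⟩
      · simp
      · obtain ⟨u, hu, hu'⟩ := he a ha ha0
        obtain ⟨v, hv, hv'⟩ := he b hb hb0
        rw [map_sub, map_sub, hg, hg, hu', hv', hf, hf, sub_sub_sub_comm]
        exact Submodule.sub_mem _ (hcommon _ _ (hED u) ha u (hEv u) hu)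
          (hcommon _ _ (hED v) hb v (hEv v) hv)
    | zero => simp
    | add x y _ _ hx hy =>
      rw [map_add, map_add, add_sub_add_comm]
      exact Submodule.add_mem _ hx hy
    | smul c x _ hx =>
      rw [map_smul, map_smul, ← smul_sub]
      exact Submodule.smul_mem _ _ hx

end MvPolynomial

namespace Graph

open ChipFiring MvPolynomial

/-! ### The Laplacian and connectedness in terms of multiplicities -/

section Basic

variable {α β : Type*} (G : Graph α β)

lemma multiplicity_comm (u v : G.vertexSet) : G.multiplicity u v = G.multiplicity v u := by
  unfold multiplicity
  congr 1
  ext e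
  exact ⟨fun h => h.symm, fun h => h.symm⟩

variable {G} in
lemma multiplicity_pos_iff (hE : G.edgeSet.Finite) {u v : G.vertexSet} :
    0 < G.multiplicity u v ↔ ∃ e, G.IsLink e u v := by
  have hfin : {e | G.IsLink e u v}.Finite := hE.subset fun e h => IsLink.edge_mem h
  rw [multiplicity, Set.ncard_pos hfin]
  rfl

variable {G} in
lemma connected_induce_iff (hE : G.edgeSet.Finite) (A : Set G.vertexSet) :
    (G.underlying.induce A).Connected ↔ Conn G.multiplicity A := by
  constructor
  · intro h
    refine ⟨Set.nonempty_coe_sort.1 h.nonempty, fun Y hYA ⟨y, hy⟩ hcl z hz => ?_⟩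
    have key : ∀ u v : A, (G.underlying.induce A).Walk u v → u.1 ∈ Y → v.1 ∈ Y := by
      intro u v p
      induction p with
      | nil => exact id
      | cons hadj _ ih =>
        exact fun hu => ih (hcl _ hu _ (Subtype.coe_prop _) ((multiplicity_pos_iff hE).2 hadj.2))
    obtain ⟨p⟩ := h.preconnected ⟨y, hYA hy⟩ ⟨z, hz⟩
    exact key _ _ p hy
  · rintro ⟨⟨x, hx⟩, h⟩
    have hreach : ∀ y : A, (G.underlying.induce A).Reachable ⟨x, hx⟩ y := by
      intro y
      have hsub := h {z | ∃ hz : z ∈ A, (G.underlying.induce A).Reachable ⟨x, hx⟩ ⟨z, hz⟩}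
        (fun z hz => hz.1) ⟨x, hx, SimpleGraph.Reachable.refl _⟩ ?_ y.2
      · exact hsub.2
      rintro u ⟨huA, hu⟩ v hv huv
      refine ⟨hv, ?_⟩
      by_cases huv' : u = v
      · subst huv'
        exact hu
      · exact hu.trans (SimpleGraph.Adj.reachable ⟨huv', (multiplicity_pos_iff hE).1 huv⟩)
    have : Nonempty A := ⟨⟨x, hx⟩⟩
    exact ⟨fun u v => (hreach u).symm.trans (hreach v)⟩

variable {G} in
lemma conn_univ (hE : G.edgeSet.Finite) (hG : G.underlying.Connected) :
    Conn G.multiplicity Set.univ := by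
  rw [← connected_induce_iff hE]
  exact (SimpleGraph.induceUnivIso G.underlying).connected_iff.2 hG

variable [Fintype G.vertexSet]

lemma laplacian_mulVec (τ : G.vertexSet → ℤ) :
    G.laplacian.mulVec τ = lap G.multiplicity τ := by
  classical
  ext v
  rw [lap_apply, Matrix.mulVec, dotProduct, ← Finset.add_sum_erase _ _ (Finset.mem_univ v),
    ← Finset.add_sum_erase Finset.univ (fun w => (G.multiplicity v w : ℤ) * (τ v - τ w))
      (Finset.mem_univ v), sub_self, mul_zero, zero_add]
  simp only [laplacian, Matrix.of_apply, if_true, Finset.filter_ne', Finset.sum_mul,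
    ← Finset.sum_add_distrib]
  have : ∀ w ∈ Finset.univ.erase v, ¬ v = w := fun w hw h =>
    (Finset.mem_erase.1 hw).1 h.symm
  refine Finset.sum_congr rfl fun w hw => ?_
  rw [if_neg (this w hw)]
  ring

lemma divClass_eq_iff {a b : G.vertexSet → ℤ} :
    G.divClass a = G.divClass b ↔ ∃ τ, b = a - lap G.multiplicity τ := by
  rw [divClass, divClass, Submodule.Quotient.eq]
  simp only [LinearMap.mem_range, Matrix.mulVecLin_apply, laplacian_mulVec]
  exact exists_congr fun τ => ⟨fun h => by rw [h]; abel, fun h => by rw [h]; abel⟩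

lemma weight_varDegree (a : G.vertexSet →₀ ℕ) :
    Finsupp.weight G.varDegree a = G.divClass fun v => (a v : ℤ) := by
  classical
  rw [Finsupp.weight_apply, Finsupp.sum_fintype _ _ (by simp)]
  have h : (fun v => (a v : ℤ)) = ∑ v, a v • (Pi.single v 1 : G.vertexSet → ℤ) := by
    ext u
    simp [Pi.single_apply]
  rw [h]
  change _ = Submodule.mkQ _ _
  rw [map_sum]
  refine Finset.sum_congr rfl fun v _ => ?_
  rw [map_nsmul]
  simp only [varDegree, divClass, Submodule.mkQ_apply]

lemma topplingIdeal_eq : G.topplingIdeal = binomialIdeal G.varDegree := by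
  simp only [topplingIdeal, binomialIdeal, weight_varDegree]

lemma sum_lap (τ : G.vertexSet → ℤ) : ∑ v, lap G.multiplicity τ v = 0 := by
  have h : ∑ v, lap G.multiplicity τ v = -∑ v, lap G.multiplicity τ v := by
    conv_lhs => simp only [lap_apply]
    rw [Finset.sum_comm, ← Finset.sum_neg_distrib]
    refine Finset.sum_congr rfl fun v _ => ?_
    rw [lap_apply, ← Finset.sum_neg_distrib]
    refine Finset.sum_congr rfl fun u _ => ?_
    rw [G.multiplicity_comm u v]
    ring
  omega

/-- The toppling grading is positive: vectors in the image of the Laplacian have coordinate sum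
zero, and a nonnegative vector of sum zero vanishes. -/
lemma eq_zero_of_weight_eq_zero (a : G.vertexSet →₀ ℕ)
    (h : Finsupp.weight G.varDegree a = 0) : a = 0 := by
  rw [← map_zero (Finsupp.weight (R := ℕ) G.varDegree), weight_varDegree, weight_varDegree,
    divClass_eq_iff] at h
  obtain ⟨τ, hτ⟩ := h
  have h1 : ∑ v, (a v : ℤ) = 0 := by
    have h2 : ∀ v, (a v : ℤ) = lap G.multiplicity τ v := fun v => by
      have := congrFun hτ v
      simp only [Finsupp.coe_zero, Pi.zero_apply, Nat.cast_zero, Pi.sub_apply] at this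
      omega
    rw [← sum_lap G τ]
    exact Finset.sum_congr rfl fun v _ => h2 v
  ext v
  have := (Finset.sum_eq_zero_iff_of_nonneg (fun v _ => Int.natCast_nonneg (a v))).1 h1 v
    (Finset.mem_univ v)
  simpa using this

variable {G} in
/-- The exponent of the monomial of an effective divisor. -/
def exponent (a : G.vertexSet → ℤ) : G.vertexSet →₀ ℕ :=
  Finsupp.equivFunOnFinite.symm fun v => (a v).toNat

variable {G} in
lemma exponent_natCast (b : G.vertexSet →₀ ℕ) : exponent (fun v => (b v : ℤ)) = b := by
  ext v
  simp [exponent]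

variable {G} in
lemma natCast_exponent {a : G.vertexSet → ℤ} (ha : 0 ≤ a) : (fun v => (exponent a v : ℤ)) = a := by
  ext v
  simpa [exponent] using ha v

variable {G} in
lemma weight_exponent {a : G.vertexSet → ℤ} (ha : 0 ≤ a) :
    Finsupp.weight G.varDegree (exponent a) = G.divClass a := by
  rw [weight_varDegree, natCast_exponent ha]

variable {G} in
lemma exponent_ne_zero {a : G.vertexSet → ℤ} {v : G.vertexSet} (hv : 0 < a v) :
    exponent a v ≠ 0 := by
  simpa [exponent] using hv

lemma mem_supportComplex_iff (D : G.ClGroup) (W : Finset G.vertexSet) :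
    W ∈ G.supportComplex D ↔
      ∃ a : G.vertexSet →₀ ℕ, Finsupp.weight G.varDegree a = D ∧ W ⊆ a.support := by
  constructor
  · rintro ⟨D₀, ⟨h0, hD⟩, hW⟩
    refine ⟨exponent D₀, by rw [weight_exponent h0, hD], fun v hv => ?_⟩
    have h1 : D₀ v ≠ 0 := hW hv
    have h2 : 0 ≤ D₀ v := h0 v
    exact Finsupp.mem_support_iff.2 (exponent_ne_zero (by omega))
  · rintro ⟨a, ha, hW⟩
    rw [weight_varDegree] at ha
    refine ⟨_, ⟨fun v => Int.natCast_nonneg (a v), ha⟩, fun v hv => ?_⟩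
    simpa using hW hv

end Basic

/-! ### Cuts and minimal binomials -/

section Cuts

variable {α β : Type*} (G : Graph α β)

/-- The cuts of `G`, each represented by its part not containing `q`. -/
abbrev CutSide (q : G.vertexSet) : Type _ :=
  {U : Set G.vertexSet // q ∉ U ∧ Conn G.multiplicity U ∧ Conn G.multiplicity Uᶜ}

variable [Fintype G.vertexSet]

variable {G} in
/-- The class of the divisor of a cut. -/
def cutClass {q : G.vertexSet} (U : G.CutSide q) : G.ClGroup := G.divClass (bd G.multiplicity U.1)

variable {G} in
/-- The binomial of a set of vertices. -/
def cutBinomial (U : Set G.vertexSet) : MvPolynomial G.vertexSet ℂ :=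
  monomial (exponent (bd G.multiplicity U)) 1 - monomial (exponent (bd G.multiplicity Uᶜ)) 1

variable {G} in
lemma cutBinomial_compl (U : Set G.vertexSet) : cutBinomial Uᶜ = -cutBinomial U := by
  rw [cutBinomial, cutBinomial, compl_compl, neg_sub]

lemma divClass_bd_compl (U : Set G.vertexSet) :
    G.divClass (bd G.multiplicity Uᶜ) = G.divClass (bd G.multiplicity U) :=
  (G.divClass_eq_iff.2 ⟨ind U, (bd_compl_eq U).symm⟩).symm

lemma sub_mem_binomialSpan {D : G.ClGroup} {a b : G.vertexSet → ℤ} (ha : 0 ≤ a) (hb : 0 ≤ b)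
    (haD : G.divClass a = D) (hbD : G.divClass b = D) {v : G.vertexSet} (hav : 0 < a v)
    (hbv : 0 < b v) :
    (monomial (exponent a) 1 - monomial (exponent b) 1 : MvPolynomial G.vertexSet ℂ) ∈
      binomialSpan G.varDegree CommonSupport D :=
  Submodule.subset_span ⟨_, _, by rw [weight_exponent ha, haD], by rw [weight_exponent hb, hbD],
    ⟨v, exponent_ne_zero hav, exponent_ne_zero hbv⟩, rfl⟩

/-- The binomial of a set that is not connected is not a minimal generator. -/
lemma cutBinomial_mem_of_not_conn (hm : Conn G.multiplicity Set.univ) {D : G.ClGroup}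
    {U : Set G.vertexSet} (hU : U.Nonempty) (hUc : ¬ Conn G.multiplicity U)
    (hD : G.divClass (bd G.multiplicity U) = D) :
    cutBinomial U ∈ binomialSpan G.varDegree CommonSupport D := by
  obtain ⟨τ, h0, ⟨v, hv, hv'⟩, u, hu, hu'⟩ :=
    exists_meeting_of_not_conn G.multiplicity_comm hm hU hUc
  have hcl : G.divClass (bd G.multiplicity U - lap G.multiplicity τ) = D :=
    (G.divClass_eq_iff.2 ⟨τ, rfl⟩).symm.trans hD
  rw [cutBinomial, ← sub_add_sub_cancel _
    (monomial (exponent (bd G.multiplicity U - lap G.multiplicity τ)) 1)]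
  exact Submodule.add_mem _ (G.sub_mem_binomialSpan (bd_nonneg U) h0 hD hcl hv hv')
    (G.sub_mem_binomialSpan h0 (bd_nonneg _) hcl ((G.divClass_bd_compl U).trans hD) hu' hu)

/-- The binomial is zero if a side is empty and non-minimal if a side is disconnected. Otherwise it
is, up to sign, the binomial of the side avoiding `q`. -/
lemma cutBinomial_mem (hm : Conn G.multiplicity Set.univ) (q : G.vertexSet) {D : G.ClGroup}
    (U : Set G.vertexSet) (hD : G.divClass (bd G.multiplicity U) = D) :
    cutBinomial U ∈
      Submodule.span ℂ (Set.range fun t : {t : G.CutSide q // cutClass t = D} =>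
        cutBinomial t.1.1) ⊔ binomialSpan G.varDegree CommonSupport D := by
  have hDc := (G.divClass_bd_compl U).trans hD
  have hneg : ∀ {p : Submodule ℂ (MvPolynomial G.vertexSet ℂ)},
      cutBinomial Uᶜ ∈ p → cutBinomial U ∈ p := fun h => by
    rwa [cutBinomial_compl, Submodule.neg_mem_iff] at h
  have hzero : bd G.multiplicity (∅ : Set G.vertexSet) = 0 := by
    ext v
    exact bd_of_notMem (Set.notMem_empty v)
  have hzero' : bd G.multiplicity (Set.univ : Set G.vertexSet) = 0 := by
    ext v
    simp [bd]
  rcases U.eq_empty_or_nonempty with rfl | hU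
  · simp [cutBinomial, hzero, hzero']
  rcases Uᶜ.eq_empty_or_nonempty with hU0 | hU0
  · rw [Set.compl_empty_iff] at hU0
    subst hU0
    simp [cutBinomial, hzero, hzero']
  by_cases hc : Conn G.multiplicity U
  · by_cases hc' : Conn G.multiplicity Uᶜ
    · refine Submodule.mem_sup_left ?_
      by_cases hq : q ∈ U
      · exact hneg (Submodule.subset_span
          ⟨⟨⟨Uᶜ, not_not.2 hq, hc', by rwa [compl_compl]⟩, hDc⟩, rfl⟩)
      · exact Submodule.subset_span ⟨⟨⟨U, hq, hc, hc'⟩, hD⟩, rfl⟩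
    · exact Submodule.mem_sup_right (hneg (G.cutBinomial_mem_of_not_conn hm hU0 hc' hDc))
  · exact Submodule.mem_sup_right (G.cutBinomial_mem_of_not_conn hm hU hc hD)

/-- Every binomial of degree `D` is a combination of the binomials of cuts, up to non-minimal
binomials. -/
lemma binomialSpan_le (hm : Conn G.multiplicity Set.univ) (q : G.vertexSet) (D : G.ClGroup) :
    binomialSpan G.varDegree (fun _ _ => True) D ≤
      Submodule.span ℂ (Set.range fun t : {t : G.CutSide q // cutClass t = D} =>
        cutBinomial t.1.1) ⊔ binomialSpan G.varDegree CommonSupport D := by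
  refine Submodule.span_le.2 ?_
  rintro _ ⟨a, b, ha, hb, -, rfl⟩
  rw [weight_varDegree] at ha hb
  obtain ⟨τ, hτ⟩ := G.divClass_eq_iff.1 (ha.trans hb.symm)
  -- The binomial telescopes along a chain of legal firings. Each step has a common support vertex
  -- or is the binomial of the fired set.
  have key := chain_induction (m := G.multiplicity) (σ := τ) (a := fun v => (a v : ℤ))
    (R := fun c c' => G.divClass c = D → G.divClass c' = D ∧
      (monomial (exponent c) 1 - monomial (exponent c') 1 : MvPolynomial G.vertexSet ℂ) ∈
        Submodule.span ℂ (Set.range fun t : {t : G.CutSide q // cutClass t = D} =>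
          cutBinomial t.1.1) ⊔ binomialSpan G.varDegree CommonSupport D)
    (fun c _ hc => ⟨hc, by rw [sub_self]; exact Submodule.zero_mem _⟩) ?_ ?_
    (fun v => Int.natCast_nonneg _) (hτ ▸ fun v => Int.natCast_nonneg _) ha
  · have := key.2
    rwa [← hτ, exponent_natCast, exponent_natCast] at this
  · intro c c' c'' h h' hc
    obtain ⟨h1, h2⟩ := h hc
    obtain ⟨h3, h4⟩ := h' h1
    refine ⟨h3, ?_⟩
    rw [← sub_add_sub_cancel _ (monomial (exponent c') 1)]
    exact Submodule.add_mem _ h2 h4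
  · intro c U hc hc' hcD
    have hcD' : G.divClass (c - lap G.multiplicity (ind U)) = D :=
      (G.divClass_eq_iff.2 ⟨_, rfl⟩).symm.trans hcD
    refine ⟨hcD', ?_⟩
    by_cases hv : ∃ v, 0 < c v ∧ 0 < (c - lap G.multiplicity (ind U)) v
    · obtain ⟨v, hv, hv'⟩ := hv
      exact Submodule.mem_sup_right (G.sub_mem_binomialSpan hc hc' hcD hcD' hv hv')
    · obtain ⟨h1, h2⟩ := eq_bd_of_disjoint hc hc' hv
      rw [h2, h1]
      exact G.cutBinomial_mem hm q U (h1 ▸ hcD)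

/-! ### Functionals dual to the cut binomials -/

open Classical in
/-- The indicator functional of the far side of a cut. -/
def farSideFunctional (q : G.vertexSet) (U : Set G.vertexSet) :
    MvPolynomial G.vertexSet ℂ →ₗ[ℂ] ℂ :=
  (basisMonomials G.vertexSet ℂ).constr ℂ fun b =>
    if FarSide G.multiplicity q U (fun v => (b v : ℤ)) then 1 else 0

open Classical in
lemma farSideFunctional_monomial (q : G.vertexSet) (U : Set G.vertexSet) (b : G.vertexSet →₀ ℕ) :
    G.farSideFunctional q U (monomial b 1) =
      if FarSide G.multiplicity q U (fun v => (b v : ℤ)) then 1 else 0 := by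
  have := (basisMonomials G.vertexSet ℂ).constr_basis ℂ (fun b =>
    if FarSide G.multiplicity q U (fun v => (b v : ℤ)) then (1 : ℂ) else 0) b
  rwa [coe_basisMonomials] at this

/-- Exponents with a common support vertex lie on the same side, so the functional descends to the
quotient by non-minimal binomials. -/
lemma farSideFunctional_eq_zero {q : G.vertexSet} (U : G.CutSide q) (D : G.ClGroup)
    {x : MvPolynomial G.vertexSet ℂ} (hx : x ∈ binomialSpan G.varDegree CommonSupport D) :
    G.farSideFunctional q U.1 x = 0 := by
  classical
  have key : ∀ a b : G.vertexSet →₀ ℕ, Finsupp.weight G.varDegree a = D →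
      Finsupp.weight G.varDegree b = D → CommonSupport a b →
      FarSide G.multiplicity q U.1 (fun v => (a v : ℤ)) →
      FarSide G.multiplicity q U.1 (fun v => (b v : ℤ)) := by
    rintro a b ha hb ⟨v, hav, hbv⟩ hP
    rw [weight_varDegree] at ha hb
    obtain ⟨τ, hτ⟩ := G.divClass_eq_iff.1 (ha.trans hb.symm)
    rw [hτ]
    refine farSide_of_common_support U.2.2.1 U.2.2.2 U.2.1 (fun v => Int.natCast_nonneg _)
      (hτ ▸ fun v => Int.natCast_nonneg _) (v := v) ?_ ?_ hP
    · exact Int.natCast_pos.2 (Nat.pos_of_ne_zero hav)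
    · rw [← hτ]
      exact Int.natCast_pos.2 (Nat.pos_of_ne_zero hbv)
  induction hx using Submodule.span_induction with
  | mem x hx =>
    obtain ⟨a, b, ha, hb, hab, rfl⟩ := hx
    have hiff : FarSide G.multiplicity q U.1 (fun v => (a v : ℤ)) ↔
        FarSide G.multiplicity q U.1 (fun v => (b v : ℤ)) :=
      ⟨key a b ha hb hab, key b a hb ha (hab.imp fun v h => ⟨h.2, h.1⟩)⟩
    rw [map_sub, farSideFunctional_monomial, farSideFunctional_monomial]
    rw [if_congr hiff rfl rfl, sub_self]
  | zero => rw [map_zero]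
  | add x y _ _ hx hy => rw [map_add, hx, hy, add_zero]
  | smul c x _ hx => rw [map_smul, hx, smul_zero]

-- The duality that makes the cut binomials independent: the firing of a cut crosses between the
-- sides of that cut and of no other.
open Classical in
lemma farSideFunctional_cutBinomial (hm : Conn G.multiplicity Set.univ) {q : G.vertexSet}
    (U W : G.CutSide q) :
    G.farSideFunctional q U.1 (cutBinomial W.1) = if W = U then 1 else 0 := by
  rw [cutBinomial, map_sub, farSideFunctional_monomial, farSideFunctional_monomial,
    natCast_exponent (bd_nonneg _), natCast_exponent (bd_nonneg _)]
  split_ifs with h1 h2 h3 h3 h2 h3 h3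
  · subst h3
    exact absurd h2 (not_farSide_bd_compl hm W.2.1 W.2.2.1.1)
  · simp
  · simp
  · exact absurd ((farSide_bd_iff U.2.2.1 U.2.2.2 U.2.1 W.2.1
      (fun h => h3 (Subtype.ext h))).1 h1) h2
  · subst h3
    exact absurd (farSide_bd q W.1) h1
  · exact absurd ((farSide_bd_iff U.2.2.1 U.2.2.2 U.2.1 W.2.1
      (fun h => h3 (Subtype.ext h))).2 h2) h1
  · subst h3
    exact absurd (farSide_bd q W.1) h1
  · simp

/-- The cuts of class `D` count the minimal binomials of degree `D`. -/
theorem finrank_eq_card_cutSide (hm : Conn G.multiplicity Set.univ) (q : G.vertexSet)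
    (D : G.ClGroup) :
    Module.finrank ℂ (binomialSpan G.varDegree (fun _ _ => True) D ⧸
      (binomialSpan G.varDegree CommonSupport D).submoduleOf
        (binomialSpan G.varDegree (fun _ _ => True) D)) =
      Nat.card {t : G.CutSide q // cutClass t = D} := by
  classical
  have : Fintype {t : G.CutSide q // cutClass t = D} := Fintype.ofFinite _
  rw [Nat.card_eq_fintype_card]
  refine finrank_subquotient_eq_card (fun t => cutBinomial t.1.1) ?_ ?_ ?_
  · intro t
    exact Submodule.subset_span ⟨_, _, (weight_exponent (bd_nonneg _)).trans t.2,
      (weight_exponent (bd_nonneg _)).trans ((G.divClass_bd_compl _).trans t.2), trivial, rfl⟩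
  · intro c hc
    ext t
    have h := G.farSideFunctional_eq_zero t.1 D hc
    simp only [map_sum, map_smul, G.farSideFunctional_cutBinomial hm, smul_eq_mul] at h
    rw [Finset.sum_eq_single t (fun s _ hs => by
      rw [if_neg (fun h => hs (Subtype.ext h)), mul_zero]) (by simp), if_pos rfl, mul_one] at h
    exact h
  · intro x hx
    obtain ⟨y, hy, z, hz, rfl⟩ := Submodule.mem_sup.1 (G.binomialSpan_le hm q D hx)
    obtain ⟨c, rfl⟩ := (Submodule.mem_span_range_iff_exists_fun ℂ).1 hy
    exact ⟨c, by rwa [add_sub_cancel_left]⟩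

lemma _root_.finsum_card_fiber {T A : Type*} [Finite T] (f : T → A) :
    ∑ᶠ D, Nat.card {t // f t = D} = Nat.card T := by
  classical
  have := Fintype.ofFinite T
  rw [finsum_eq_sum_of_support_subset (s := Finset.univ.image f), Nat.card_eq_fintype_card,
    ← Finset.card_univ, Finset.card_eq_sum_card_image f]
  · refine Finset.sum_congr rfl fun D _ => ?_
    rw [Nat.card_eq_fintype_card, Fintype.card_subtype]
  · intro D hD
    rw [Function.mem_support] at hD
    obtain ⟨⟨t, rfl⟩⟩ := (Nat.card_pos_iff.1 (Nat.pos_of_ne_zero hD)).1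
    simp

end Cuts

/-! ### Cuts as partitions -/

section Partitions

variable {α β : Type*} {G : Graph α β}

lemma isPartition_pair {V : Type*} {U : Set V} (hU : U.Nonempty) (hU' : Uᶜ.Nonempty) :
    Setoid.IsPartition ({U, Uᶜ} : Set (Set V)) := by
  refine ⟨?_, fun v => ?_⟩
  · rintro (h | h)
    · exact hU.ne_empty h.symm
    · exact hU'.ne_empty (Set.mem_singleton_iff.1 h).symm
  · by_cases hv : v ∈ U
    · refine ⟨U, ⟨Or.inl rfl, hv⟩, ?_⟩
      rintro _ ⟨rfl | rfl, h⟩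
      · rfl
      · exact absurd hv h
    · refine ⟨Uᶜ, ⟨Or.inr rfl, hv⟩, ?_⟩
      rintro _ ⟨rfl | rfl, h⟩
      · exact absurd h hv
      · rfl

lemma exists_eq_pair_of_isPartition {V : Type*} {P : Set (Set V)} (hP : Setoid.IsPartition P)
    (h2 : P.ncard = 2) (q : V) : ∃ U, q ∉ U ∧ P = {U, Uᶜ} := by
  obtain ⟨A, B, hAB, rfl⟩ := Set.ncard_eq_two.1 h2
  have hcompl : B = Aᶜ := by
    ext v
    obtain ⟨C, ⟨hC, hv⟩, huniq⟩ := hP.2 v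
    constructor
    · intro hB hA
      exact hAB ((huniq A ⟨Or.inl rfl, hA⟩).trans (huniq B ⟨Or.inr rfl, hB⟩).symm)
    · intro hA
      rcases hC with rfl | rfl
      · exact absurd hv hA
      · exact hv
  subst hcompl
  by_cases hq : q ∈ A
  · exact ⟨Aᶜ, not_not.2 hq, by rw [compl_compl, Set.pair_comm]⟩
  · exact ⟨A, hq, rfl⟩

/-- Exactly one part of a cut avoids `q`, so each unordered partition is counted once. -/
theorem card_cutSide (hE : G.edgeSet.Finite) (q : G.vertexSet) :
    Nat.card (G.CutSide q) = (G.connectedPartitions 2).ncard := by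
  rw [← Nat.card_coe_set_eq]
  refine Nat.card_congr (Equiv.ofBijective (fun U => ⟨{U.1, U.1ᶜ},
    isPartition_pair U.2.2.1.1 U.2.2.2.1, Set.ncard_pair ?_, ?_⟩) ⟨?_, ?_⟩)
  · intro h
    obtain ⟨x, hx⟩ := U.2.2.1.1
    exact (h ▸ hx : x ∈ U.1ᶜ) hx
  · rintro A (rfl | rfl)
    · exact (connected_induce_iff hE _).2 U.2.2.1
    · exact (connected_induce_iff hE _).2 U.2.2.2
  · intro U W h
    have h1 : U.1 ∈ ({W.1, W.1ᶜ} : Set (Set G.vertexSet)) := by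
      have h2 : ({U.1, U.1ᶜ} : Set (Set G.vertexSet)) = {W.1, W.1ᶜ} := congrArg Subtype.val h
      rw [← h2]
      exact Or.inl rfl
    rcases h1 with h1 | h1
    · exact Subtype.ext h1
    · exact absurd (h1.symm ▸ W.2.1 : q ∈ U.1) U.2.1
  · rintro ⟨P, hP, h2, hconn⟩
    obtain ⟨U, hq, rfl⟩ := exists_eq_pair_of_isPartition hP h2 q
    exact ⟨⟨U, hq, (connected_induce_iff hE _).1 (hconn U (Or.inl rfl)),
      (connected_induce_iff hE _).1 (hconn Uᶜ (Or.inr rfl))⟩, rfl⟩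

end Partitions

/-! ### Parking functions on two vertices -/

section Parking

variable {α β : Type*}

/-- A script not firing the sink fires `t` some `k ≥ 1` times, at a cost of `k` times the
multiplicity, so `k = 1` is the decisive test. -/
lemma isParking_iff_of_two_vertices (H : Graph α β) [Fintype H.vertexSet] {s t : H.vertexSet}
    (hts : t ≠ s) (hall : ∀ v, v = s ∨ v = t) (c : {v : H.vertexSet // v ≠ s} → ℕ) :
    H.IsParking s c ↔ c ⟨t, hts⟩ < H.multiplicity t s := by
  classical
  have hval : ∀ τ : H.vertexSet → ℤ, τ s = 0 →
      H.laplacian.mulVec τ t = H.multiplicity t s * τ t := fun τ hτ => by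
    rw [laplacian_mulVec, lap_apply, Finset.sum_eq_single s, hτ, sub_zero]
    · intro v _ hv
      rw [(hall v).resolve_left hv, sub_self, mul_zero]
    · simp
  rw [IsParking, not_iff_comm, not_lt]
  constructor
  · intro h
    refine ⟨Pi.single t 1, Pi.single_nonneg.2 zero_le_one, by simp, by simp [hts.symm], ?_⟩
    rintro ⟨v, hv⟩
    obtain rfl := (hall v).resolve_left hv
    rw [hval _ (by simp [hts.symm])]
    simpa using h
  · rintro ⟨τ, h0, hne, hs, hpos⟩
    have h1 := hpos ⟨t, hts⟩
    rw [hval τ hs] at h1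
    have h2 : τ t ≠ 0 := fun ht => hne (funext fun v => by
      rcases hall v with rfl | rfl
      · exact hs
      · exact ht)
    have h3 : 1 ≤ τ t := by
      have : 0 ≤ τ t := h0 t
      omega
    have h4 : (H.multiplicity t s : ℤ) ≤ H.multiplicity t s * τ t :=
      le_mul_of_one_le_right (by positivity) h3
    have h5 : (H.multiplicity t s : ℤ) ≤ c ⟨t, hts⟩ := by linarith
    exact_mod_cast h5

lemma ncard_maximalParking_of_two_vertices (H : Graph α β) [Fintype H.vertexSet]
    {s t : H.vertexSet} (hts : t ≠ s) (hall : ∀ v, v = s ∨ v = t) (hm : 0 < H.multiplicity t s) :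
    (H.maximalParking s).ncard = 1 := by
  rw [Set.ncard_eq_one]
  refine ⟨fun _ => H.multiplicity t s - 1, Set.ext fun c => ?_⟩
  simp only [maximalParking, Set.mem_ofPred_eq, isParking_iff_of_two_vertices H hts hall,
    Set.mem_singleton_iff]
  have huniq : ∀ v : {v : H.vertexSet // v ≠ s}, v = ⟨t, hts⟩ := fun v =>
    Subtype.ext ((hall v.1).resolve_left v.2)
  constructor
  · rintro ⟨h1, h2⟩
    have h3 := h2 ⟨t, hts⟩
    simp only [Pi.add_apply, Pi.single_eq_same] at h3
    ext v
    rw [huniq v]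
    omega
  · rintro rfl
    refine ⟨Nat.sub_lt hm one_pos, fun v => ?_⟩
    rw [huniq v]
    simp only [Pi.add_apply, Pi.single_eq_same]
    omega

/-- A two-vertex contraction of a connected graph has exactly one maximal parking function. -/
theorem ncard_maximalParking_contract {G : Graph α β} (hE : G.edgeSet.Finite)
    (hm : Conn G.multiplicity Set.univ) (P : Set (Set G.vertexSet)) (hP : Setoid.IsPartition P)
    (h2 : P.ncard = 2) [Fintype (G.contract P hP).vertexSet] (s : (G.contract P hP).vertexSet) :
    ((G.contract P hP).maximalParking s).ncard = 1 := by
  obtain ⟨q, -⟩ := hm.1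
  obtain ⟨U, -, hPU⟩ := exists_eq_pair_of_isPartition hP h2 q
  have hsP : s.1 ∈ P := s.2
  obtain ⟨A, hPA, hsA⟩ : ∃ A, P = {A, Aᶜ} ∧ s.1 = Aᶜ := by
    have hsP' : s.1 ∈ ({U, Uᶜ} : Set (Set G.vertexSet)) := Eq.subset hPU hsP
    rcases hsP' with h | h
    · exact ⟨Uᶜ, by rw [hPU, compl_compl, Set.pair_comm], by rw [h, compl_compl]⟩
    · exact ⟨U, hPU, h⟩
  have hAP : A ∈ P := by rw [hPA]; exact Or.inl rfl
  have hAne : A.Nonempty := Set.nonempty_iff_ne_empty.2 fun h => hP.1 (h ▸ hAP)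
  have hA'ne : Aᶜ ≠ ∅ := fun h => hP.1 (by rw [← h, ← hsA]; exact hsP)
  have hEc : (G.contract P hP).edgeSet.Finite := by
    refine hE.subset fun e he => ?_
    obtain ⟨B, C, -, -, u, -, v, -, h⟩ := (Graph.edge_mem_iff_exists_isLink _ _).1 he
    exact h.edge_mem
  -- Connectedness gives an edge between the two parts, so the contracted multigraph has positive
  -- multiplicity between its vertices.
  obtain ⟨x, hx, y, hy, hxy⟩ := hm.exists_edge hAne (fun h => hA'ne (by rw [h, Set.compl_univ]))
  obtain ⟨e, he⟩ := (multiplicity_pos_iff hE).1 hxy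
  refine ncard_maximalParking_of_two_vertices _ (t := ⟨A, hAP⟩) ?_ ?_ ?_
  · intro h
    have h' : A = Aᶜ := (congrArg Subtype.val h).trans hsA
    exact (h' ▸ hx : x ∈ Aᶜ) hx
  · intro v
    have hv : v.1 ∈ ({A, Aᶜ} : Set (Set G.vertexSet)) := Eq.subset hPA v.2
    rcases hv with h | h
    · exact Or.inr (Subtype.ext h)
    · exact Or.inl (Subtype.ext (h.trans hsA.symm))
  · refine (multiplicity_pos_iff hEc).2 ⟨e, hAP, hsP, x, hx, y, ?_, he⟩
    rw [hsA]
    exact hy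

end Parking

end Graph

end

theorem theorem2p1 {α β : Type*} (G : Graph α β) [Fintype G.vertexSet] (hE : G.edgeSet.Finite)
    (hG : G.underlying.Connected) :
    -- the minimal free resolution of the coordinate ring of the toppling ideal exists
    Nonempty (MinimalFreeResolution G.varDegree G.topplingIdeal) ∧
    ∀ F : MinimalFreeResolution G.varDegree G.topplingIdeal,
      -- the first coarse Betti number is the number of cuts
      F.coarseBetti 1 = (G.connectedPartitions 2).ncard ∧
      -- the first fine Betti numbers are given by the reduced homology of the complexes `Δ_D`
      (∀ D : G.ClGroup,
        F.betti 1 D = Module.finrank ℂ (ReducedHomologyZero (G.supportComplex D))) ∧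
      -- the formula in terms of maximal parking functions, for any choice of sinks
      (∀ s : ∀ P : G.connectedPartitions 2, (G.contract P.1 P.2.1).vertexSet,
        F.coarseBetti 1 =
          ∑ᶠ P : G.connectedPartitions 2, ((G.contract P.1 P.2.1).maximalParking (s P)).ncard) := by
  have hm := Graph.conn_univ hE hG
  have hw := G.eq_zero_of_weight_eq_zero
  obtain ⟨q, -⟩ := hm.1
  rw [G.topplingIdeal_eq]
  refine ⟨MinimalFreeResolution.nonempty_of_homogeneous hw
    MvPolynomial.component_mem_binomialIdeal (MvPolynomial.binomialIdeal_le hw), fun F => ?_⟩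
  have hcuts : F.coarseBetti 1 = (G.connectedPartitions 2).ncard := by
    rw [MinimalFreeResolution.coarseBetti, ← Graph.card_cutSide hE q,
      ← finsum_card_fiber (Graph.cutClass (q := q))]
    refine finsum_congr fun D => ?_
    rw [MvPolynomial.betti_one_binomialIdeal hw, G.finrank_eq_card_cutSide hm q]
  refine ⟨hcuts, fun D => ?_, fun s => ?_⟩
  · rw [MvPolynomial.betti_one_binomialIdeal hw,
      MvPolynomial.finrank_reducedHomologyZero_eq hw D _ (G.mem_supportComplex_iff D)]
  · have hone : ∀ P : G.connectedPartitions 2,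
        ((G.contract P.1 P.2.1).maximalParking (s P)).ncard = 1 := fun P =>
      Graph.ncard_maximalParking_contract hE hm P.1 P.2.1 P.2.2.1 _
    have := Fintype.ofFinite (G.connectedPartitions 2)
    rw [hcuts, finsum_congr hone, finsum_eq_sum_of_fintype, ← Nat.card_coe_set_eq,
      Nat.card_eq_fintype_card]
    simp
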